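/- Let $n$ and $k$ be integers with $1\le k\le n-2$, and let $G$ be the simply connected simple algebraic group over $\mathbb{C}$ of type $D_n$ (so $n\ge 3$; type $D_3$ is $A_3$), with simple roots indexed by $I=\{1,\dots,n\}$, where $i$ and $i+1$ are joined for $1\le i\le n-2$ and $n-2$ and $n$ are joined in the Dynkin diagram. Let $e_i,f_i$ be the Chevalley generators, $x_i(t)=\exp(te_i)$, $y_i(t)=\exp(tf_i)$, let $\alpha_i^\vee:\mathbb{C}^\times\to G$ be the simple coroots, $T$ the maximal torus they generate, $U$ and $U^-$ the maximal unipotent subgroups generated by the $x_i(t)$ and by the $y_i(t)$, and $\Lambda_i$ the fundamental weights. Put $\overline{s}_i=x_i(-1)y_i(1)x_i(-1)$, and for a Weyl group element $w$ with a reduced expression $w=s_{i_1}\cdots s_{i_l}$ put $\overline{w}=\overline{s}_{i_1}\cdots\overline{s}_{i_l}$. Let $w_0$ be the longest element, with the reduced word $\mathbf{i}_0=(1,2,\dots,n)^{n-1}$. Let $\Delta_{\Lambda_k}$ be the regular function on $G$ with $\Delta_{\Lambda_k}(u^-tu^+)=\Lambda_k(t)$ for $u^-\in U^-$, $t\in T$,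 $u^+\in U$, and for $u,v$ in the Weyl group let $\Delta_{u\Lambda_k,v\Lambda_k}(g)=\Delta_{\Lambda_k}(\overline{u}^{\,-1}g\,\overline{v})$. For $c=(c^{(p)}_i)_{1\le p\le n-1,\,1\le i\le n}\in(\mathbb{C}^\times)^{n(n-1)}$ let $$\Theta^-_{\mathbf{i}_0}(c)=\prod_{p=1}^{n-1}\Big(\mathbf{y}_1(c^{(p)}_1)\,\mathbf{y}_2(c^{(p)}_2)\cdots\mathbf{y}_n(c^{(p)}_n)\Big),\qquad \mathbf{y}_i(a)=y_i(a)\,\alpha_i^\vee(a^{-1}),$$ the product over $p$ being taken in increasing order from left to right. Then for every such $c$ $$\Delta_{w_0s_k\Lambda_k,\Lambda_k}\big(\Theta^-_{\mathbf{i}_0}(c)\big)=\frac{1}{c^{(k)}_1}+\sum_{j=1}^{k-1}\frac{c^{(j)}_{k-j}}{c^{(j)}_{k-j+1}} .$$ -/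

import Mathlib

/-! Type `D_n`: the simply connected group, generalized minors of fundamental weights, and the
parametrization attached to the reduced word `(1, 2, …, n)^{n-1}` of the longest element. -/

namespace TypeD

/-- The index set `I = {1, 2, …, n}` of the simple roots. -/
abbrev Idx (n : ℕ) : Type := {i : ℕ // i ∈ Finset.Icc 1 n}

/-- Basis of the vector representation `V(Λ₁)`: `inl a` is `v_a`, `inr a` is `v_{\bar a}`. -/
abbrev VecBasis (n : ℕ) : Type := Idx n ⊕ Idx n

/-- Basis of the sum `V(Λ_{n-1}) ⊕ V(Λ_n)` of the two spin representations: sign vectors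
`(ε_1, …, ε_n)`, with `true` for `+` and `false` for `-` (the product of the signs separates the
two summands). -/
abbrev SpinBasis (n : ℕ) : Type := Idx n → Bool

/-- Basis of `V = V(Λ₁) ⊕ V(Λ_{n-1}) ⊕ V(Λ_n)`. Its weights generate the whole weight lattice. -/
abbrev Basis (n : ℕ) : Type := VecBasis n ⊕ SpinBasis n

/-- `vecArrow i b b'` says that `f_i` maps `b` to `b'` in the vector representation:
`f_i v_i = v_{i+1}` and `f_i v_{\bar{i+1}} = v_{\bar i}` for `i < n`, and
`f_n v_{n-1} = v_{\bar n}`, `f_n v_n = v_{\bar{n-1}}`. -/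
def vecArrow {n : ℕ} (i : Idx n) : VecBasis n → VecBasis n → Prop
  | .inl a, .inl a' => i.1 < n ∧ a.1 = i.1 ∧ a'.1 = i.1 + 1
  | .inr a, .inr a' => i.1 < n ∧ a.1 = i.1 + 1 ∧ a'.1 = i.1
  | .inl a, .inr a' => i.1 = n ∧ ((a.1 + 1 = n ∧ a'.1 = n) ∨ (a.1 = n ∧ a'.1 + 1 = n))
  | .inr _, .inl _ => False

/-- `spinArrow i ε ε'` says that `f_i` maps `ε` to `ε'` in the spin representations: for `i < n`
the signs `(ε_i, ε_{i+1}) = (+, -)` become `(-, +)`, and for `i = n` the signs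
`(ε_{n-1}, ε_n) = (+, +)` become `(-, -)`; all other signs are unchanged. -/
def spinArrow {n : ℕ} (i : Idx n) (ε ε' : SpinBasis n) : Prop :=
  ∃ j : Idx n,
    ((i.1 < n ∧ j.1 = i.1 + 1 ∧ ε i = true ∧ ε j = false ∧ ε' i = false ∧ ε' j = true) ∨
      (i.1 = n ∧ j.1 + 1 = n ∧ ε i = true ∧ ε j = true ∧ ε' i = false ∧ ε' j = false)) ∧
    ∀ l : Idx n, l ≠ i → l ≠ j → ε' l = ε l

/-- `arrow i b b'` says that `f_i` maps the basis vector `b` of `V` to `b'`. -/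
def arrow {n : ℕ} (i : Idx n) : Basis n → Basis n → Prop
  | .inl b, .inl b' => vecArrow i b b'
  | .inr ε, .inr ε' => spinArrow i ε ε'
  | _, _ => False

open Classical in
/-- The matrix of the Chevalley generator `f_i` on `V`. -/
noncomputable def f {n : ℕ} (i : Idx n) : Matrix (Basis n) (Basis n) ℂ :=
  Matrix.of fun b' b => if arrow i b b' then 1 else 0

open Classical in
/-- The matrix of the Chevalley generator `e_i` on `V`: it maps `b'` to `b` exactly when `f_i`
maps `b` to `b'`. -/
noncomputable def e {n : ℕ} (i : Idx n) : Matrix (Basis n) (Basis n) ℂ :=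
  Matrix.of fun b b' => if arrow i b b' then 1 else 0

theorem arrow_not_comp {n : ℕ} (i : Idx n) {b b' b'' : Basis n}
    (h : arrow i b b') (h' : arrow i b' b'') : False := by
  rcases b with (b | b) | b <;> rcases b' with (b' | b') | b' <;>
    rcases b'' with (b'' | b'') | b'' <;>
    simp only [arrow, vecArrow] at h h' <;> try omega
  obtain ⟨j, h, -⟩ := h
  obtain ⟨j', h', -⟩ := h'
  rcases h with h | h <;> rcases h' with h' | h' <;> simp_all

theorem e_mul_e {n : ℕ} (i : Idx n) : e i * e i = 0 := by
  ext b b''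
  rw [Matrix.mul_apply]
  refine Finset.sum_eq_zero fun b' _ => ?_
  by_cases h : arrow i b b'
  · have h' : ¬ arrow i b' b'' := fun h' => arrow_not_comp i h h'
    simp [e, h']
  · simp [e, h]

theorem f_mul_f {n : ℕ} (i : Idx n) : f i * f i = 0 := by
  ext b'' b
  rw [Matrix.mul_apply]
  refine Finset.sum_eq_zero fun b' _ => ?_
  by_cases h : arrow i b b'
  · have h' : ¬ arrow i b' b'' := fun h' => arrow_not_comp i h h'
    simp [f, h']
  · simp [f, h]

theorem isNilpotent_smul {n : ℕ} {A : Matrix (Basis n) (Basis n) ℂ} (hA : A * A = 0) (t : ℂ) :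
    IsNilpotent (t • A) :=
  ⟨2, by rw [pow_two, smul_mul_smul_comm, hA, smul_zero]⟩

/-- `exp (t A)` as an invertible matrix, for a matrix `A` with `A² = 0`. -/
noncomputable def expUnit {n : ℕ} (A : Matrix (Basis n) (Basis n) ℂ) (hA : A * A = 0) (t : ℂ) :
    GL (Basis n) ℂ where
  val := IsNilpotent.exp (t • A)
  inv := IsNilpotent.exp (-(t • A))
  val_inv := IsNilpotent.exp_mul_exp_neg_self (isNilpotent_smul hA t)
  inv_val := IsNilpotent.exp_neg_mul_exp_self (isNilpotent_smul hA t)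

/-- The simply connected simple algebraic group `G` over `ℂ` of type `D_n`: the group of
automorphisms of `V` generated by all `exp (t e_i)` and `exp (t f_i)`. -/
def G (n : ℕ) : Subgroup (GL (Basis n) ℂ) :=
  Subgroup.closure {g | ∃ (i : Idx n) (t : ℂ),
    g = expUnit (e i) (e_mul_e i) t ∨ g = expUnit (f i) (f_mul_f i) t}

/-- `x_i(t) = exp (t e_i) ∈ G`. -/
noncomputable def x {n : ℕ} (i : Idx n) (t : ℂ) : G n :=
  ⟨expUnit (e i) (e_mul_e i) t, Subgroup.subset_closure ⟨i, t, Or.inl rfl⟩⟩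

/-- `y_i(t) = exp (t f_i) ∈ G`. -/
noncomputable def y {n : ℕ} (i : Idx n) (t : ℂ) : G n :=
  ⟨expUnit (f i) (f_mul_f i) t, Subgroup.subset_closure ⟨i, t, Or.inr rfl⟩⟩

/-- `\bar s_i = x_i(-1) y_i(1) x_i(-1)`, the representative in `G` of the simple reflection. -/
noncomputable def sBar {n : ℕ} (i : Idx n) : G n := x i (-1) * y i 1 * x i (-1)

/-- The coroot subgroup `α_i^∨(c) = φ_i(diag(c, c⁻¹))`, where `φ_i : SL₂(ℂ) → G` sends the
elementary matrices to `x_i(t)`, `y_i(t)`. It is the image of the identity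
`diag(c, c⁻¹) = (1 c; 0 1) (1 0; -c⁻¹ 1) (1 c; 0 1) · (0 -1; 1 0)` in `SL₂(ℂ)`. -/
noncomputable def coroot {n : ℕ} (i : Idx n) (c : ℂˣ) : G n :=
  x i c * y i (-(c⁻¹ : ℂˣ)) * x i c * sBar i

/-- `𝐲_i(c) = y_i(c) α_i^∨(c⁻¹)`. -/
noncomputable def yBold {n : ℕ} (i : Idx n) (c : ℂˣ) : G n := y i c * coroot i c⁻¹

/-- The word `1, 2, …, n`. -/
def cycleWord (n : ℕ) : List (Idx n) :=
  List.ofFn fun i : Fin n => ⟨i.1 + 1, Finset.mem_Icc.mpr ⟨by omega, by omega⟩⟩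

/-- The representative `\bar w₀` in `G` of the longest element `w₀`, from its reduced word
`(1, 2, …, n)^{n-1}`. -/
noncomputable def w₀Bar (n : ℕ) : G n := ((cycleWord n).map sBar).prod ^ (n - 1)

/-- The representative of `w₀ s_k`. Since `ℓ(w₀ s_k) = ℓ(w₀) - 1`, appending `k` to a reduced word
of `w₀ s_k` gives a reduced word of `w₀`, so that `\bar w₀ = \overline{w₀ s_k} \bar s_k`. -/
noncomputable def w₀sBar {n : ℕ} (k : Idx n) : G n := w₀Bar n * (sBar k)⁻¹

/-- `Θ(c) = ∏_{p=1}^{n-1} 𝐲_1(c_1^{(p)}) 𝐲_2(c_2^{(p)}) ⋯ 𝐲_n(c_n^{(p)})`, the product being taken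
in this order; `c p i` is `c_i^{(p)}`. -/
noncomputable def Θ (n : ℕ) (c : ℕ → ℕ → ℂˣ) : G n :=
  (List.ofFn fun p : Fin (n - 1) =>
    ((cycleWord n).map fun i => yBold i (c (p.1 + 1) i.1)).prod).prod

/-- The principal minor `Δ_{Λ_k}` for `1 ≤ k ≤ n - 2`, where `V(Λ_k)` is generated by
`u = v_1 ∧ ⋯ ∧ v_k` in the exterior power of `V(Λ₁)`: the coefficient `⟨g u, u⟩` of `u` in `g u`,
which is a polynomial function of `g`. By `principalMinor_bigCell` it takes the value `Λ_k(t)` at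
`u⁻ t u⁺`. -/
noncomputable def principalMinor {n : ℕ} (k : Idx n) (g : G n) : ℂ :=
  Matrix.det (Matrix.of fun a b : {a : Idx n // a.1 ≤ k.1} =>
    (g : GL (Basis n) ℂ).1 (.inl (.inl a.1)) (.inl (.inl b.1)))

/-- The generalized minor `Δ_{uΛ_k, vΛ_k}(g) = Δ_{Λ_k}(\bar u⁻¹ g \bar v)`, given by the
representatives `\bar u`, `\bar v`. -/
noncomputable def generalizedMinor {n : ℕ} (k : Idx n) (uBar vBar g : G n) : ℂ :=
  principalMinor k (uBar⁻¹ * g * vBar)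

/-- The maximal unipotent subgroup `U`, generated by the `x_i(t)`. -/
def UPlus (n : ℕ) : Subgroup (G n) := Subgroup.closure {g | ∃ (i : Idx n) (t : ℂ), g = x i t}

/-- The maximal unipotent subgroup `U⁻`, generated by the `y_i(t)`. -/
def UMinus (n : ℕ) : Subgroup (G n) := Subgroup.closure {g | ∃ (i : Idx n) (t : ℂ), g = y i t}

theorem arrow_inj_right {n : ℕ} (i : Idx n) {b b' b'' : Basis n}
    (h : arrow i b b') (h' : arrow i b b'') : b' = b'' := by
  rcases b with (b | b) | b <;> rcases b' with (b' | b') | b' <;>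
    rcases b'' with (b'' | b'') | b'' <;>
    simp only [arrow, vecArrow] at h h' <;>
    first
    | (simp only [Sum.inl.injEq, Sum.inr.injEq, Subtype.ext_iff]; omega)
    | omega
    | skip
  obtain ⟨j, h, hl⟩ := h
  obtain ⟨j', h', hl'⟩ := h'
  have hj : j = j' := Subtype.ext (by omega)
  subst hj
  congr 1
  funext l
  by_cases h1 : l = i
  · subst h1; rcases h with h | h <;> rcases h' with h' | h' <;> simp_all
  by_cases h2 : l = j
  · subst h2
    rcases h with h | h <;> rcases h' with h' | h' <;> first | omega | simp_all
  rw [hl l h1 h2, hl' l h1 h2]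

theorem arrow_inj_left {n : ℕ} (i : Idx n) {b b' b'' : Basis n}
    (h : arrow i b b'') (h' : arrow i b' b'') : b = b' := by
  rcases b with (b | b) | b <;> rcases b' with (b' | b') | b' <;>
    rcases b'' with (b'' | b'') | b'' <;>
    simp only [arrow, vecArrow] at h h' <;>
    first
    | (simp only [Sum.inl.injEq, Sum.inr.injEq, Subtype.ext_iff]; omega)
    | omega
    | skip
  obtain ⟨j, h, hl⟩ := h
  obtain ⟨j', h', hl'⟩ := h'
  have hj : j = j' := Subtype.ext (by omega)
  subst hj
  congr 1
  funext l
  by_cases h1 : l = i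
  · subst h1; rcases h with h | h <;> rcases h' with h' | h' <;> simp_all
  by_cases h2 : l = j
  · subst h2
    rcases h with h | h <;> rcases h' with h' | h' <;> first | omega | simp_all
  rw [← hl l h1 h2, ← hl' l h1 h2]

/-- The matrix by which `g ∈ G` acts on `V`. -/
def mat {n : ℕ} (g : G n) : Matrix (Basis n) (Basis n) ℂ := (g : GL (Basis n) ℂ).1

theorem mat_mul {n : ℕ} (g h : G n) : mat (g * h) = mat g * mat h := rfl

theorem mat_one {n : ℕ} : mat (1 : G n) = 1 := rfl

theorem mat_x {n : ℕ} (i : Idx n) (t : ℂ) : mat (x i t) = 1 + t • e i := by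
  change IsNilpotent.exp (t • e i) = _
  rw [IsNilpotent.exp_eq_sum (k := 2)
    (by rw [pow_two, smul_mul_smul_comm, e_mul_e, smul_zero])]
  simp [Finset.sum_range_succ]

theorem mat_y {n : ℕ} (i : Idx n) (t : ℂ) : mat (y i t) = 1 + t • f i := by
  change IsNilpotent.exp (t • f i) = _
  rw [IsNilpotent.exp_eq_sum (k := 2)
    (by rw [pow_two, smul_mul_smul_comm, f_mul_f, smul_zero])]
  simp [Finset.sum_range_succ]

open Classical in
theorem e_mul_f {n : ℕ} (i : Idx n) :
    e i * f i = Matrix.diagonal fun b => if ∃ b', arrow i b b' then (1 : ℂ) else 0 := by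
  ext b b'
  rw [Matrix.mul_apply, Matrix.diagonal_apply]
  simp only [e, f, Matrix.of_apply]
  by_cases h : ∃ d, arrow i b d
  · obtain ⟨d, hd⟩ := h
    rw [Finset.sum_eq_single d]
    · have : arrow i b' d ↔ b = b' := ⟨fun h => arrow_inj_left i hd h, fun h => h ▸ hd⟩
      have h' : ∃ d, arrow i b d := ⟨d, hd⟩
      simp [hd, this, h']
    · intro d' _ hne
      have : ¬ arrow i b d' := fun h => hne (arrow_inj_right i h hd)
      simp [this]
    · simp
  · rw [if_neg h, ite_self]
    push Not at h
    simp [h]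

open Classical in
theorem f_mul_e {n : ℕ} (i : Idx n) :
    f i * e i = Matrix.diagonal fun b => if ∃ b', arrow i b' b then (1 : ℂ) else 0 := by
  ext b b'
  rw [Matrix.mul_apply, Matrix.diagonal_apply]
  simp only [e, f, Matrix.of_apply]
  by_cases h : ∃ d, arrow i d b
  · obtain ⟨d, hd⟩ := h
    rw [Finset.sum_eq_single d]
    · have : arrow i d b' ↔ b = b' := ⟨fun h => arrow_inj_right i hd h, fun h => h ▸ hd⟩
      have h' : ∃ d, arrow i d b := ⟨d, hd⟩
      simp [hd, this, h']
    · intro d' _ hne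
      have : ¬ arrow i d' b := fun h => hne (arrow_inj_left i h hd)
      simp [this]
    · simp
  · rw [if_neg h, ite_self]
    push Not at h
    simp [h]

theorem e_mul_f_mul_e {n : ℕ} (i : Idx n) : e i * f i * e i = e i := by
  classical
  rw [e_mul_f]
  ext b b'
  rw [Matrix.diagonal_mul]
  by_cases h : arrow i b b'
  · have h' : ∃ d, arrow i b d := ⟨b', h⟩
    simp [e, h, h']
  · simp [e, h]

theorem f_mul_e_mul_f {n : ℕ} (i : Idx n) : f i * e i * f i = f i := by
  classical
  rw [f_mul_e]
  ext b b'
  rw [Matrix.diagonal_mul]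
  by_cases h : arrow i b' b
  · have h' : ∃ d, arrow i d b := ⟨b', h⟩
    simp [f, h, h']
  · simp [f, h]

/-- `α_i^∨(c)` acts on `V` as `c^{h_i}`, where `h_i = e_i f_i - f_i e_i`. -/
theorem mat_coroot {n : ℕ} (i : Idx n) (c : ℂˣ) :
    mat (coroot i c) =
      1 + ((c : ℂ) - 1) • (e i * f i) + ((c : ℂ)⁻¹ - 1) • (f i * e i) := by
  have hc : (c : ℂ) ≠ 0 := c.ne_zero
  have key : ∀ s : ℂ, s ≠ 0 → (1 + s • e i) * (1 + (-s⁻¹) • f i) * (1 + s • e i) =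
      1 + s • e i - s⁻¹ • f i - e i * f i - f i * e i := by
    intro s hs
    simp only [mul_add, add_mul, one_mul, mul_one, smul_mul_assoc, mul_smul_comm, e_mul_e,
      e_mul_f_mul_e, smul_zero]
    match_scalars <;> field_simp <;> ring
  have h1 := key c hc
  have h2 := key (-1) (by norm_num)
  rw [inv_neg, inv_one, neg_neg] at h2
  simp only [coroot, sBar, mat_mul, mat_x, mat_y]
  rw [Units.val_inv_eq_inv_val, h1, h2]
  have a1 := e_mul_e i
  have a2 := f_mul_f i
  have a3 := e_mul_f_mul_e i
  have a4 := f_mul_e_mul_f i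
  have a5 : e i * (f i * e i) = e i := by rw [← mul_assoc, a3]
  have a6 : f i * (e i * f i) = f i := by rw [← mul_assoc, a4]
  have a7 : e i * (e i * f i) = 0 := by rw [← mul_assoc, a1, zero_mul]
  have a8 : f i * (f i * e i) = 0 := by rw [← mul_assoc, a2, zero_mul]
  have a9 : e i * f i * (e i * f i) = e i * f i := by rw [← mul_assoc, a3]
  have a10 : f i * e i * (f i * e i) = f i * e i := by rw [← mul_assoc, a4]
  have a11 : e i * f i * (f i * e i) = 0 := by rw [mul_assoc, a8, mul_zero]
  have a12 : f i * e i * (e i * f i) = 0 := by rw [mul_assoc, a7, mul_zero]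
  have a13 : e i * f i * f i = 0 := by rw [mul_assoc, a2, mul_zero]
  have a14 : f i * e i * e i = 0 := by rw [mul_assoc, a1, mul_zero]
  simp only [mul_add, add_mul, mul_sub, sub_mul, one_mul, mul_one, smul_mul_assoc,
    mul_smul_comm, a1, a2, a3, a4, a5, a6, a7, a8, a9, a10, a11, a12, a13, a14,
    smul_zero]
  module

/-- Index set of the span of `v_1, …, v_k`. -/
def IsHead {n : ℕ} (k : Idx n) : Basis n → Prop
  | .inl (.inl a) => a.1 ≤ k.1
  | _ => False

theorem head_sum {n : ℕ} (k : Idx n) (F : Basis n → ℂ) (hF : ∀ b, ¬ IsHead k b → F b = 0) :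
    ∑ b, F b = ∑ a : {a : Idx n // a.1 ≤ k.1}, F (.inl (.inl a.1)) := by
  classical
  symm
  refine Finset.sum_of_injOn (fun a => .inl (.inl a.1)) ?_ (by simp) ?_ (by simp)
  · intro a _ b _ h
    exact Subtype.ext (Sum.inl.inj (Sum.inl.inj h))
  · intro b _ hb
    apply hF
    intro h
    apply hb
    rcases b with (a | a) | a
    · exact ⟨⟨a, h⟩, by simp, rfl⟩
    · exact h.elim
    · exact h.elim

theorem principalMinor_mul_of_right {n : ℕ} (k : Idx n) (g h : G n)
    (hh : ∀ a b, ¬ IsHead k a → IsHead k b → mat h a b = 0) :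
    principalMinor k (g * h) = principalMinor k g * principalMinor k h := by
  unfold principalMinor
  rw [← Matrix.det_mul]
  congr 1
  ext a b
  change mat (g * h) _ _ = ∑ d : {a : Idx n // a.1 ≤ k.1}, mat g _ _ * mat h _ _
  rw [mat_mul, Matrix.mul_apply]
  exact head_sum k (fun d => mat g (.inl (.inl a.1)) d * mat h d (.inl (.inl b.1)))
    fun d hd => by rw [hh d (.inl (.inl b.1)) hd b.2, mul_zero]

theorem principalMinor_mul_of_left {n : ℕ} (k : Idx n) (g h : G n)
    (hg : ∀ a b, IsHead k a → ¬ IsHead k b → mat g a b = 0) :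
    principalMinor k (g * h) = principalMinor k g * principalMinor k h := by
  unfold principalMinor
  rw [← Matrix.det_mul]
  congr 1
  ext a b
  change mat (g * h) _ _ = ∑ d : {a : Idx n // a.1 ≤ k.1}, mat g _ _ * mat h _ _
  rw [mat_mul, Matrix.mul_apply]
  exact head_sum k (fun d => mat g (.inl (.inl a.1)) d * mat h d (.inl (.inl b.1)))
    fun d hd => by rw [hg (.inl (.inl a.1)) d a.2 hd, zero_mul]

theorem principalMinor_one {n : ℕ} (k : Idx n) : principalMinor k (1 : G n) = 1 := by
  classical
  unfold principalMinor
  rw [← Matrix.det_one (n := {a : Idx n // a.1 ≤ k.1})]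
  congr 1
  ext a b
  change (1 : Matrix (Basis n) (Basis n) ℂ) _ _ = _
  simp only [Matrix.one_apply, Sum.inl.injEq, Subtype.ext_iff]

theorem uPlus_head {n : ℕ} (k : Idx n) (u : G n) (hu : u ∈ UPlus n) :
    (∀ a b, ¬ IsHead k a → IsHead k b → mat u a b = 0) ∧ principalMinor k u = 1 := by
  classical
  have gen : ∀ (i : Idx n) (t : ℂ),
      (∀ a b, ¬ IsHead k a → IsHead k b → mat (x i t) a b = 0) ∧
        principalMinor k (x i t) = 1 := by
    intro i t
    constructor
    · intro a b ha hb
      have hab : a ≠ b := fun h => ha (h ▸ hb)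
      have : ¬ arrow i a b := by
        intro h
        rcases a with (a | a) | a <;> rcases b with (b | b) | b <;>
          simp only [IsHead, arrow, vecArrow] at *; omega
      simp [mat_x, e, hab, this]
    · unfold principalMinor
      rw [Matrix.det_of_isUpperTriangular]
      · refine Finset.prod_eq_one fun a _ => ?_
        change mat (x i t) _ _ = 1
        have : ¬ arrow i (.inl (.inl a.1)) (.inl (.inl a.1)) := by
          simp only [arrow, vecArrow]; omega
        simp [mat_x, e, this]
      · intro a b hab
        change mat (x i t) _ _ = 0
        have hab : b.1.1 < a.1.1 := hab
        have h1 : a.1 ≠ b.1 := fun h => by rw [h] at hab; omega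
        have : ¬ arrow i (.inl (.inl a.1)) (.inl (.inl b.1)) := by
          simp only [arrow, vecArrow]; omega
        simp [mat_x, e, this, h1]
  have mul : ∀ g h : G n, ((∀ a b, ¬ IsHead k a → IsHead k b → mat g a b = 0) ∧
      principalMinor k g = 1) → ((∀ a b, ¬ IsHead k a → IsHead k b → mat h a b = 0) ∧
      principalMinor k h = 1) → ((∀ a b, ¬ IsHead k a → IsHead k b → mat (g * h) a b = 0) ∧
      principalMinor k (g * h) = 1) := by
    rintro g h ⟨hg, hg1⟩ ⟨hh, hh1⟩
    refine ⟨fun a b ha hb => ?_, by rw [principalMinor_mul_of_right k g h hh, hg1, hh1, one_mul]⟩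
    rw [mat_mul, Matrix.mul_apply]
    refine Finset.sum_eq_zero fun d _ => ?_
    by_cases hd : IsHead k d
    · rw [hg a d ha hd, zero_mul]
    · rw [hh d b hd hb, mul_zero]
  have inv : ∀ (i : Idx n) (t : ℂ), (x i t)⁻¹ = x i (-t) := by
    intro i t
    rw [inv_eq_iff_mul_eq_one]
    apply Subtype.ext
    apply Units.ext
    change mat (x i t) * mat (x i (-t)) = 1
    rw [mat_x, mat_x]
    simp [mul_add, add_mul, e_mul_e]
  induction hu using Subgroup.closure_induction'' with
  | mem g hg => obtain ⟨i, t, rfl⟩ := hg; exact gen i t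
  | inv_mem g hg => obtain ⟨i, t, rfl⟩ := hg; rw [inv]; exact gen i (-t)
  | one =>
    refine ⟨fun a b ha hb => ?_, principalMinor_one k⟩
    have hab : a ≠ b := fun h => ha (h ▸ hb)
    simp [mat_one, hab]
  | mul g h _ _ hg hh => exact mul g h hg hh

theorem uMinus_head {n : ℕ} (k : Idx n) (u : G n) (hu : u ∈ UMinus n) :
    (∀ a b, IsHead k a → ¬ IsHead k b → mat u a b = 0) ∧ principalMinor k u = 1 := by
  classical
  have gen : ∀ (i : Idx n) (t : ℂ),
      (∀ a b, IsHead k a → ¬ IsHead k b → mat (y i t) a b = 0) ∧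
        principalMinor k (y i t) = 1 := by
    intro i t
    constructor
    · intro a b ha hb
      have hab : a ≠ b := fun h => hb (h ▸ ha)
      have : ¬ arrow i b a := by
        intro h
        rcases a with (a | a) | a <;> rcases b with (b | b) | b <;>
          simp only [IsHead, arrow, vecArrow] at *; omega
      simp [mat_y, f, hab, this]
    · unfold principalMinor
      rw [Matrix.det_of_isLowerTriangular]
      · refine Finset.prod_eq_one fun a _ => ?_
        change mat (y i t) _ _ = 1
        have : ¬ arrow i (.inl (.inl a.1)) (.inl (.inl a.1)) := by
          simp only [arrow, vecArrow]; omega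
        simp [mat_y, f, this]
      · intro a b hab
        change mat (y i t) _ _ = 0
        have hab : a.1.1 < b.1.1 := hab
        have h1 : a.1 ≠ b.1 := fun h => by rw [h] at hab; omega
        have : ¬ arrow i (.inl (.inl b.1)) (.inl (.inl a.1)) := by
          simp only [arrow, vecArrow]; omega
        simp [mat_y, f, this, h1]
  have inv : ∀ (i : Idx n) (t : ℂ), (y i t)⁻¹ = y i (-t) := by
    intro i t
    rw [inv_eq_iff_mul_eq_one]
    apply Subtype.ext
    apply Units.ext
    change mat (y i t) * mat (y i (-t)) = 1
    rw [mat_y, mat_y]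
    simp [mul_add, add_mul, f_mul_f]
  induction hu using Subgroup.closure_induction'' with
  | mem g hg => obtain ⟨i, t, rfl⟩ := hg; exact gen i t
  | inv_mem g hg => obtain ⟨i, t, rfl⟩ := hg; rw [inv]; exact gen i (-t)
  | one =>
    refine ⟨fun a b ha hb => ?_, principalMinor_one k⟩
    have hab : a ≠ b := fun h => hb (h ▸ ha)
    simp [mat_one, hab]
  | mul g h _ _ hg hh =>
    refine ⟨fun a b ha hb => ?_, by
      rw [principalMinor_mul_of_left k g h hg.1, hg.2, hh.2, one_mul]⟩
    rw [mat_mul, Matrix.mul_apply]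
    refine Finset.sum_eq_zero fun d _ => ?_
    by_cases hd : IsHead k d
    · rw [hh.1 d b hd hb, mul_zero]
    · rw [hg.1 a d ha hd, zero_mul]

theorem coroot_head {n : ℕ} (k : Idx n) (hk : k.1 ≤ n - 2) (i : Idx n) (c : ℂˣ) :
    (∀ a b, ¬ IsHead k a → IsHead k b → mat (coroot i c) a b = 0) ∧
      principalMinor k (coroot i c) = if i = k then (c : ℂ) else 1 := by
  classical
  obtain ⟨i, hi⟩ := i
  obtain ⟨k, hk'⟩ := k
  have hi' := Finset.mem_Icc.mp hi
  have hkk := Finset.mem_Icc.mp hk'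
  simp only at hk
  constructor
  · intro a b ha hb
    have hab : a ≠ b := fun h => ha (h ▸ hb)
    rw [mat_coroot, e_mul_f, f_mul_e]
    simp [hab]
  · have hdiag : (Matrix.of fun a b : {a : Idx n // a.1 ≤ k} =>
        mat (coroot ⟨i, hi⟩ c) (.inl (.inl a.1)) (.inl (.inl b.1))) =
        Matrix.diagonal fun a => (if a.1.1 = i then (c : ℂ) else 1) *
          (if a.1.1 = i + 1 then (c : ℂ)⁻¹ else 1) := by
      ext a b
      obtain ⟨⟨a, ha'⟩, ha⟩ := a
      simp only at ha
      have haa := Finset.mem_Icc.mp ha'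
      rw [Matrix.of_apply, mat_coroot, e_mul_f, f_mul_e, Matrix.diagonal_apply]
      by_cases hab : (⟨⟨a, ha'⟩, ha⟩ : {a : Idx n // a.1 ≤ k}) = b
      · subst hab
        have h1 : (∃ d, arrow (⟨i, hi⟩ : Idx n) (.inl (.inl ⟨a, ha'⟩)) d) ↔ a = i := by
          constructor
          · rintro ⟨(d | d) | d, h⟩ <;> simp only [arrow, vecArrow] at h <;> omega
          · rintro rfl
            exact ⟨.inl (.inl ⟨a + 1, Finset.mem_Icc.mpr ⟨by omega, by omega⟩⟩),
              by simp only [arrow, vecArrow, and_true]; omega⟩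
        have h2 : (∃ d, arrow (⟨i, hi⟩ : Idx n) d (.inl (.inl ⟨a, ha'⟩))) ↔ a = i + 1 := by
          constructor
          · rintro ⟨(d | d) | d, h⟩ <;> simp only [arrow, vecArrow] at h <;> omega
          · rintro rfl
            exact ⟨.inl (.inl ⟨i, hi⟩), by simp only [arrow, vecArrow, and_true]; omega⟩
        simp only [Matrix.add_apply, Matrix.one_apply_eq, Matrix.smul_apply,
          Matrix.diagonal_apply_eq, h1, h2, if_true]
        by_cases h3 : a = i
        · have h4 : a ≠ i + 1 := by omega
          simp [h3]
        · simp [h3]; split_ifs <;> simp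
      · have hab' : (⟨a, ha'⟩ : Idx n) ≠ b.1 := fun h => hab (Subtype.ext h)
        simp [hab, hab']
    change Matrix.det (Matrix.of fun a b : {a : Idx n // a.1 ≤ k} =>
        mat (coroot ⟨i, hi⟩ c) (.inl (.inl a.1)) (.inl (.inl b.1))) = _
    rw [hdiag, Matrix.det_diagonal, Finset.prod_mul_distrib]
    have hprod : ∀ (m : ℕ) (z : ℂ), 1 ≤ m →
        ∏ a : {a : Idx n // a.1 ≤ k}, (if a.1.1 = m then z else 1) =
          if m ≤ k then z else 1 := by
      intro m z hm
      by_cases h : m ≤ k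
      · rw [if_pos h, Finset.prod_eq_single
          (⟨⟨m, Finset.mem_Icc.mpr ⟨hm, by omega⟩⟩, h⟩ : {a : Idx n // a.1 ≤ k})]
        · simp
        · intro b _ hb
          rw [if_neg]
          intro h'
          exact hb (Subtype.ext (Subtype.ext h'))
        · simp
      · rw [if_neg h]
        refine Finset.prod_eq_one fun a _ => if_neg ?_
        have := a.2
        omega
    rw [hprod i c (by omega), hprod (i + 1) _ (by omega)]
    have hik : ((⟨i, hi⟩ : Idx n) = ⟨k, hk'⟩) ↔ i = k := by simp
    simp only [hik]
    rcases lt_trichotomy i k with h | h | h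
    · have h1 : i ≤ k := by omega
      have h2 : i + 1 ≤ k := by omega
      simp [h1, h2, h.ne]
    · subst h; simp
    · have h1 : ¬ i ≤ k := by omega
      have h2 : ¬ i + 1 ≤ k := by omega
      simp [h1, h2, h.ne']

/-- The defining property of the principal minor: `Δ_{Λ_k}(u⁻ t u⁺) = Λ_k(t)` for `u⁻ ∈ U⁻`,
`u⁺ ∈ U` and `t = ∏_i α_i^∨(c_i)` in the maximal torus, for which `Λ_k(t) = c_k`. -/
theorem principalMinor_bigCell {n : ℕ} (k : Idx n) (hk : k.1 ≤ n - 2) (c : Idx n → ℂˣ)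
    (u v : G n) (hu : u ∈ UMinus n) (hv : v ∈ UPlus n) :
    principalMinor k (u * ((cycleWord n).map fun i => coroot i (c i)).prod * v) = c k := by
  classical
  have hl : ∀ l : List (Idx n), principalMinor k (l.map fun i => coroot i (c i)).prod =
      (l.map fun i => if i = k then (c i : ℂ) else 1).prod := by
    intro l
    induction l using List.reverseRecOn with
    | nil => simpa using principalMinor_one k
    | append_singleton l i ih =>
      simp only [List.map_append, List.prod_append, List.map_cons, List.map_nil, List.prod_cons,
        List.prod_nil, mul_one]
      rw [principalMinor_mul_of_right k _ _ (coroot_head k hk i (c i)).1, ih,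
        (coroot_head k hk i (c i)).2]
  rw [principalMinor_mul_of_right k _ _ (uPlus_head k v hv).1, (uPlus_head k v hv).2, mul_one,
    principalMinor_mul_of_left k _ _ (uMinus_head k u hu).1, (uMinus_head k u hu).2, one_mul, hl,
    cycleWord, List.map_ofFn, List.prod_ofFn]
  have hkk := Finset.mem_Icc.mp k.2
  rw [Finset.prod_eq_single (⟨k.1 - 1, by omega⟩ : Fin n)]
  · have : (⟨k.1 - 1 + 1, Finset.mem_Icc.mpr ⟨by omega, by omega⟩⟩ : Idx n) = k :=
      Subtype.ext (by simp only; omega)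
    simp [this]
  · intro b _ hb
    simp only [Function.comp]
    rw [if_neg]
    intro h
    apply hb
    apply Fin.ext
    have := congrArg Subtype.val h
    simp only at this ⊢
    omega
  · simp

end TypeD

/-! The minor is a determinant in the vector representation. Write `v_a` and `w_a` for the row
vectors dual to `v_a` and `v_{\bar a}`. Since `\bar w₀⁻¹` sends `v_a` to `±w_a` and `\bar s_k`
replaces `v_k` by `-v_{k+1}`, it is, up to signs, the determinant of `Θ(c)` with rows `\bar 1, …,
\overline{k-1}, \overline{k+1}` and columns `1, …, k` (`generalizedMinor_eq_det`). The signs are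
exactly that of reversing the rows (`det_signed_reverse`).

Let `C = 𝐲_1(c_1) ⋯ 𝐲_n(c_n)` and `c_0 = 1`. The row identity `(c_r w_{r+1} - c_{r+1} w_{r+2}) C =
c_{r+1} w_{r+1}` (`wVec_cycle`) turns differences of suitably scaled rows for the cycles from `j +
1` on into rows for the cycles from `j + 2` on. A cycle raises the index of `v_a` by at most one, so
the column `j + 1` becomes `(1, 0, …, 0)` after these row operations. Expanding along it removes one
cycle, one row and one column.

For consecutive rows this reproduces the same determinant, which is therefore `1` (`det_extremal`).
With a gap after the top row, the operation across the gap needs the recursion twice and leaves a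
sum of two rows. One summand closes the gap and gives `c_{l+1}/c_{l+2}`; the other is the same
gapped determinant, one size smaller (`det_skip_succ`). Iterating yields the sum, and the last `1 ×
1` determinant yields `1/c^{(k)}_1`. -/

namespace TypeD

open Matrix

/-! ### Determinant identities. -/

/-- The signed antidiagonal matrix `(−1)^r δ_{r+s+1,m}` has determinant `1`. -/
theorem det_signed_antidiagonal (m : ℕ) :
    det (of fun r s : Fin m => if r.1 + s.1 + 1 = m then (-1 : ℂ) ^ r.1 else 0) = 1 := by
  induction m with
  | zero => simp
  | succ m ih =>
    rw [det_succ_column_zero, Finset.sum_eq_single (Fin.last m)]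
    · have : (of fun r s : Fin (m + 1) =>
          if r.1 + s.1 + 1 = m + 1 then (-1 : ℂ) ^ r.1 else 0).submatrix
            (Fin.last m).succAbove Fin.succ =
          of fun r s : Fin m => if r.1 + s.1 + 1 = m then (-1 : ℂ) ^ r.1 else 0 := by
        ext r s
        simp [Fin.succAbove_last, ← add_assoc]
      rw [this, ih]
      simp [← mul_pow]
    · intro r _ hr
      have : r.1 ≠ m := fun h => hr (Fin.ext h)
      simp [this]
    · simp

/-- The left side is the product of the signed antidiagonal matrix with `X`. It absorbs the signs
`(-1)^r` coming from `\bar w₀`. -/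
theorem det_signed_reverse (m : ℕ) (X : Matrix (Fin m) (Fin m) ℂ) :
    det (of fun r s : Fin m => (-1 : ℂ) ^ r.1 * X r.rev s) = det X := by
  refine Eq.trans ?_ ((det_mul _ X).trans
    (by rw [det_signed_antidiagonal m, one_mul]))
  congr 1
  ext r s
  rw [mul_apply, Finset.sum_eq_single r.rev]
  · have : r.1 + (m - (r.1 + 1)) + 1 = m := by omega
    simp [Fin.val_rev, this]
  · intro t _ ht
    have : ¬ r.1 + t.1 + 1 = m := fun h => ht (Fin.ext (by rw [Fin.val_rev]; omega))
    simp [this]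
  · simp

/-- Laplace expansion along a first column equal to `(a, 0, …, 0)`. -/
theorem det_of_column_zero_eq {m : ℕ} (A : Matrix (Fin (m + 1)) (Fin (m + 1)) ℂ)
    (h : ∀ r : Fin m, A r.succ 0 = 0) :
    det A = A 0 0 * det (of fun r s : Fin m => A r.succ s.succ) := by
  rw [det_succ_column_zero, Fin.sum_univ_succ]
  simp only [h, mul_zero, zero_mul, Finset.sum_const_zero, add_zero, Fin.val_zero, pow_zero,
    one_mul, Fin.succAbove_zero]
  rfl

theorem det_cons_linear_combination {m : ℕ} (a b : ℂ) (u v : Fin (m + 1) → ℂ)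
    (R : Fin m → Fin (m + 1) → ℂ) :
    det (of (Fin.cons (fun s => a * u s + b * v s) R : Fin (m + 1) → Fin (m + 1) → ℂ)) =
      a * det (of (Fin.cons u R : Fin (m + 1) → Fin (m + 1) → ℂ)) +
        b * det (of (Fin.cons v R : Fin (m + 1) → Fin (m + 1) → ℂ)) := by
  have h : ∀ w : Fin (m + 1) → ℂ,
      det (of (Fin.cons w R : Fin (m + 1) → Fin (m + 1) → ℂ)) =
        ∑ s, (-1) ^ s.1 * w s * det (of fun r t => R r (s.succAbove t)) := by
    intro w
    rw [det_succ_row_zero]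
    rfl
  rw [h, h, h, Finset.mul_sum, Finset.mul_sum, ← Finset.sum_add_distrib]
  exact Finset.sum_congr rfl fun s _ => by ring

/-! ### Determinants governed by the entry recursion. -/

/-- The recursion satisfied by the matrix entries `α j r s` of the product of the last
`n - 1 - j` cycles at row `\bar r` and column `s`; here `γ j i` is the parameter `c_i^{(j+1)}`
for `i ≥ 1`, and `γ j 0 = 1`. -/
structure EntryRecursion (n : ℕ) (γ : ℕ → ℕ → ℂ) (α : ℕ → ℕ → ℕ → ℂ) : Prop where
  ne_zero : ∀ j i, γ j i ≠ 0
  zero : ∀ j, γ j 0 = 1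
  step : ∀ j r s, j + 2 ≤ n → r + 3 ≤ n →
    γ j r * α j (r + 1) s = γ j (r + 1) * α (j + 1) (r + 1) s + γ j (r + 1) * α j (r + 2) s
  vanish : ∀ j r s, j + 1 ≤ n → 1 ≤ r → 1 ≤ s → s ≤ j → α j r s = 0
  first : ∀ j r, j + 2 ≤ n → r + 2 ≤ n → γ j r * α j (r + 1) (j + 1) = 1

namespace EntryRecursion

variable {n : ℕ} {γ : ℕ → ℕ → ℂ} {α : ℕ → ℕ → ℕ → ℂ}

theorem prod_ne_zero (h : EntryRecursion n γ α) (j m : ℕ) :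
    ∏ r : Fin m, γ j (m - r.1) ≠ 0 :=
  Finset.prod_ne_zero_iff.mpr fun _ _ => h.ne_zero _ _

theorem prod_succ (h : EntryRecursion n γ α) (j m : ℕ) :
    ∏ r : Fin (m + 1), γ j (m - r.1) = ∏ r : Fin m, γ j (m - r.1) := by
  rw [Fin.prod_univ_castSucc]
  simp [h.zero]

/-- Rows `m, …, 1` against columns `j + 1, …, j + m`. Scaling and subtracting adjacent rows reduces
size `m + 1` at level `j` to size `m` at level `j + 1`; the scaling factors on both sides agree
because `γ j 0 = 1`. -/
theorem det_extremal (h : EntryRecursion n γ α) (m : ℕ) :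
    ∀ j, m + j + 2 ≤ n →
      det (of fun r s : Fin m => α j (m - r.1) (j + 1 + s.1)) = 1 := by
  induction m with
  | zero => intro j _; simp
  | succ m ih =>
    intro j hj
    have e1 := det_mul_column (fun r : Fin (m + 1) => γ j (m - r.1))
      (of fun r s : Fin (m + 1) => α j (m + 1 - r.1) (j + 1 + s.1))
    have e2 : det (of fun r s : Fin (m + 1) => γ j (m - r.1) *
          (of fun r s : Fin (m + 1) => α j (m + 1 - r.1) (j + 1 + s.1)) r s) =
        det (of (Fin.cons (fun s : Fin (m + 1) => γ j m * α j (m + 1) (j + 1 + s.1))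
          fun (r : Fin m) s => γ j (m - r.1) * α (j + 1) (m - r.1) (j + 1 + s.1))) := by
      -- Each scaled row minus the one above it is, by `step`, a multiple of a row at level `j + 1`.
      refine det_eq_of_forall_row_eq_smul_add_pred (fun _ => 1) (fun s => by simp) fun r s => ?_
      have hr := r.2
      have := h.step j (m - (r.1 + 1)) (j + 1 + s.1) (by omega) (by omega)
      have a1 : m - (r.1 + 1) + 1 = m - r.1 := by omega
      have a2 : m - (r.1 + 1) + 2 = m + 1 - r.1 := by omega
      rw [a1, a2] at this
      simpa using this
    rw [e2, det_of_column_zero_eq] at e1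
    · simp only [of_apply, Fin.cons_zero, Fin.cons_succ, Fin.val_zero, add_zero] at e1
      rw [h.first j m (by omega) (by omega), one_mul] at e1
      have e3 := det_mul_column (fun r : Fin m => γ j (m - r.1))
        (of fun r s : Fin m => α (j + 1) (m - r.1) (j + 1 + 1 + s.1))
      rw [ih (j + 1) (by omega), mul_one] at e3
      have a3 : ∀ s : Fin m, j + 1 + s.succ.1 = j + 1 + 1 + s.1 := by
        intro s; rw [Fin.val_succ]; omega
      simp only [a3] at e1
      simp only [of_apply] at e3
      rw [e3, h.prod_succ] at e1
      exact mul_left_cancel₀ (h.prod_ne_zero j m) (by rw [← e1, mul_one])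
    · intro r
      have hr := r.2
      simp only [of_apply, Fin.cons_succ, Fin.val_zero, add_zero]
      rw [h.vanish (j + 1) _ _ (by omega) (by omega) (by omega) (by omega), mul_zero]

/-- Rows `l + 3, l + 1, l, …, 1`: the row `l + 2` is missing. Only the difference across the gap
behaves differently from `det_extremal`; it is a combination of the rows `l + 1` and `l + 2` at
level `j + 1`, and linearity in that row splits the determinant. -/
theorem det_skip_succ (h : EntryRecursion n γ α) (l j : ℕ) (hj : l + j + 4 ≤ n) :
    det (of (Fin.cons (fun s : Fin (l + 2) => α j (l + 3) (j + 1 + s.1))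
        fun (r : Fin (l + 1)) s => α j (l + 1 - r.1) (j + 1 + s.1))) =
      γ j (l + 1) / γ j (l + 2) +
        det (of (Fin.cons (fun s : Fin (l + 1) => α (j + 1) (l + 2) (j + 1 + 1 + s.1))
          fun (r : Fin l) s => α (j + 1) (l - r.1) (j + 1 + 1 + s.1))) := by
  have e1 := det_mul_column (Fin.cons (γ j (l + 2)) fun r : Fin (l + 1) => γ j (l - r.1))
    (of (Fin.cons (fun s : Fin (l + 2) => α j (l + 3) (j + 1 + s.1))
        fun (r : Fin (l + 1)) s => α j (l + 1 - r.1) (j + 1 + s.1)))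
  have e2 : det (of fun r s : Fin (l + 2) =>
        (Fin.cons (γ j (l + 2)) fun r : Fin (l + 1) => γ j (l - r.1) : Fin (l + 2) → ℂ) r *
        (of (Fin.cons (fun s : Fin (l + 2) => α j (l + 3) (j + 1 + s.1))
          fun (r : Fin (l + 1)) s => α j (l + 1 - r.1) (j + 1 + s.1))) r s) =
      det (of (Fin.cons (fun s : Fin (l + 2) => γ j (l + 2) * α j (l + 3) (j + 1 + s.1))
        (Fin.cons (fun s : Fin (l + 2) => γ j (l + 1) * α (j + 1) (l + 1) (j + 1 + s.1) +
            γ j (l + 2) * α (j + 1) (l + 2) (j + 1 + s.1))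
          fun (r : Fin l) s => γ j (l - r.1) * α (j + 1) (l - r.1) (j + 1 + s.1)))) := by
    refine det_eq_of_forall_row_eq_smul_add_pred (fun _ => 1) (fun s => by simp) fun r s => ?_
    refine Fin.cases ?_ (fun r => ?_) r
    -- Across the gap the recursion is applied twice; the term with the missing row `l + 2` at level
    -- `j` cancels.
    · have s1 := h.step j l (j + 1 + s.1) (by omega) (by omega)
      have s2 := h.step j (l + 1) (j + 1 + s.1) (by omega) (by omega)
      simp only [of_apply, Fin.cons_succ, Fin.cons_zero, Fin.castSucc_zero, Fin.val_zero,
        Nat.sub_zero, one_mul]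
      linear_combination s1 + s2
    · have hr := r.2
      have := h.step j (l - (r.1 + 1)) (j + 1 + s.1) (by omega) (by omega)
      have a1 : l - (r.1 + 1) + 1 = l - r.1 := by omega
      have a2 : l - (r.1 + 1) + 2 = l + 1 - r.1 := by omega
      rw [a1, a2] at this
      simpa [← Fin.succ_castSucc] using this
  rw [e2, det_of_column_zero_eq] at e1
  · simp only [of_apply, Fin.cons_zero, Fin.cons_succ, Fin.val_zero, add_zero] at e1
    rw [h.first j (l + 2) (by omega) (by omega), one_mul, Fin.prod_univ_succ] at e1
    simp only [Fin.cons_zero, Fin.cons_succ] at e1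
    rw [h.prod_succ] at e1
    have e3 := det_mul_column (Fin.cons 1 fun r : Fin l => γ j (l - r.1))
      (of (Fin.cons (fun s : Fin (l + 1) =>
          γ j (l + 1) * α (j + 1) (l + 1) (j + 1 + 1 + s.1) +
            γ j (l + 2) * α (j + 1) (l + 2) (j + 1 + 1 + s.1))
        fun (r : Fin l) s => α (j + 1) (l - r.1) (j + 1 + 1 + s.1)))
    rw [det_cons_linear_combination, Fin.prod_univ_succ] at e3
    simp only [Fin.cons_zero, Fin.cons_succ, one_mul] at e3
    -- Putting the row `l + 1` on top of `l, …, 1` leaves no gap, so this summand is an extremal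
    -- determinant, equal to `1`.
    have e4 : (of (Fin.cons (fun s : Fin (l + 1) => α (j + 1) (l + 1) (j + 1 + 1 + s.1))
        fun (r : Fin l) s => α (j + 1) (l - r.1) (j + 1 + 1 + s.1))) =
        of fun r s : Fin (l + 1) => α (j + 1) (l + 1 - r.1) (j + 1 + 1 + s.1) := by
      ext r s
      refine Fin.cases ?_ (fun r => ?_) r <;> simp
    rw [e4, h.det_extremal (l + 1) (j + 1) (by omega), mul_one] at e3
    have e5 : (of fun (r s : Fin (l + 1)) =>
        (Fin.cons (fun s : Fin (l + 2) => γ j (l + 1) * α (j + 1) (l + 1) (j + 1 + s.1) +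
            γ j (l + 2) * α (j + 1) (l + 2) (j + 1 + s.1))
          (fun (r : Fin l) s => γ j (l - r.1) * α (j + 1) (l - r.1) (j + 1 + s.1)) :
          Fin (l + 1) → Fin (l + 2) → ℂ) r s.succ) =
      of fun r s : Fin (l + 1) =>
        (Fin.cons 1 fun r : Fin l => γ j (l - r.1) : Fin (l + 1) → ℂ) r *
        (of (Fin.cons (fun s : Fin (l + 1) =>
          γ j (l + 1) * α (j + 1) (l + 1) (j + 1 + 1 + s.1) +
            γ j (l + 2) * α (j + 1) (l + 2) (j + 1 + 1 + s.1))
        fun (r : Fin l) s => α (j + 1) (l - r.1) (j + 1 + 1 + s.1))) r s := by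
      ext r s
      have a3 : j + 1 + (s.1 + 1) = j + 1 + 1 + s.1 := by omega
      refine Fin.cases ?_ (fun r => ?_) r <;> simp [a3]
    rw [e5, e3] at e1
    have h1 := h.ne_zero j (l + 2)
    have h2 := h.prod_ne_zero j l
    -- The scaling by `γ j (l + 2)` of the top row has no counterpart at the next level; dividing by
    -- it creates the denominator.
    refine mul_left_cancel₀ (mul_ne_zero h1 h2) (e1.symm.trans ?_)
    field_simp
  · intro r
    simp only [of_apply, Fin.cons_succ]
    refine Fin.cases ?_ (fun r => ?_) r
    · simp only [Fin.cons_zero, Fin.val_zero, add_zero]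
      rw [h.vanish (j + 1) _ _ (by omega) (by omega) (by omega) (by omega),
        h.vanish (j + 1) _ _ (by omega) (by omega) (by omega) (by omega)]
      simp
    · have hr := r.2
      simp only [Fin.cons_succ, Fin.val_zero, add_zero]
      rw [h.vanish (j + 1) _ _ (by omega) (by omega) (by omega) (by omega), mul_zero]

theorem det_skip (h : EntryRecursion n γ α) (l : ℕ) : ∀ j, l + j + 3 ≤ n →
    det (of (Fin.cons (fun s : Fin (l + 1) => α j (l + 2) (j + 1 + s.1))
        fun (r : Fin l) s => α j (l - r.1) (j + 1 + s.1))) =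
      ∑ i ∈ Finset.range l, γ (j + i) (l - i) / γ (j + i) (l - i + 1) + 1 / γ (j + l) 1 := by
  induction l with
  | zero =>
    intro j hj
    -- The `1 × 1` case is the single entry in row `\bar 2`, so `first` is used at index `1`.
    have := h.first j 1 (by omega) (by omega)
    simpa using eq_inv_of_mul_eq_one_right this
  | succ l ih =>
    intro j hj
    rw [h.det_skip_succ l j (by omega), ih (j + 1) (by omega), Finset.sum_range_succ']
    have : ∀ i, j + 1 + i = j + (i + 1) := fun i => by omega
    simp only [this, Nat.add_sub_add_right, Nat.sub_zero, add_zero]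
    ring

end EntryRecursion

/-! ### Action of `𝐲_i` and `\bar s_i` on basis vectors. -/

/-- On the source of an arrow the coroot contributes `c⁻¹`, which cancels the factor `c` of `c f_i`;
hence `f_i` has coefficient `1`. -/
theorem mat_yBold {n : ℕ} (i : Idx n) (c : ℂˣ) :
    mat (yBold i c) = 1 + ((c : ℂ)⁻¹ - 1) • (e i * f i) + ((c : ℂ) - 1) • (f i * e i) + f i := by
  have a1 : f i * (e i * f i) = f i := by rw [← mul_assoc, f_mul_e_mul_f]
  have a2 : f i * (f i * e i) = 0 := by rw [← mul_assoc, f_mul_f, zero_mul]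
  have hc : (c : ℂ) ≠ 0 := c.ne_zero
  rw [yBold, mat_mul, mat_y, mat_coroot, Units.val_inv_eq_inv_val, inv_inv]
  simp only [mul_add, add_mul, one_mul, mul_one, smul_mul_assoc, mul_smul_comm, a1, a2, smul_zero]
  match_scalars <;> field_simp <;> ring

theorem mat_sBar {n : ℕ} (i : Idx n) :
    mat (sBar i) = 1 - e i + f i - e i * f i - f i * e i := by
  have a3 := e_mul_f_mul_e i
  have a1 := e_mul_e i
  rw [sBar, mat_mul, mat_mul, mat_x, mat_y]
  simp only [mul_add, add_mul, one_mul, mul_one, smul_mul_assoc, mul_smul_comm, a1, a3, smul_zero]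
  module

section Arrows

variable {n : ℕ} {i : Idx n} {b b' : Basis n}

-- Arrows of a fixed `i` never compose and are injective in both directions, so the basis splits
-- into pairs `b → b'` and fixed vectors. This leaves three cases, source, target and fixed, for
-- rows and for columns.
open Classical in
theorem vecMul_yBold_source (c : ℂˣ) (h : arrow i b b') :
    Pi.single b 1 ᵥ* mat (yBold i c) = (c : ℂ)⁻¹ • Pi.single b 1 := by
  have h1 : ∃ d, arrow i b d := ⟨b', h⟩
  have h2 : ∀ d, ¬ arrow i d b := fun d hd => arrow_not_comp i hd h
  rw [mat_yBold, e_mul_f, f_mul_e]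
  ext d
  by_cases hd : d = b
  · subst hd
    simp [f, h1, h2, -Sum.exists]
  · simp [f, h2, hd, Ne.symm hd]

open Classical in
theorem vecMul_yBold_target (c : ℂˣ) (h : arrow i b b') :
    Pi.single b' 1 ᵥ* mat (yBold i c) = (c : ℂ) • Pi.single b' 1 + Pi.single b 1 := by
  have h1 : ∃ d, arrow i d b' := ⟨b, h⟩
  have h2 : ∀ d, ¬ arrow i b' d := fun d hd => arrow_not_comp i h hd
  have h3 : ∀ d, arrow i d b' ↔ d = b :=
    fun d => ⟨fun hd => arrow_inj_left i hd h, fun hd => hd ▸ h⟩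
  have h4 : b ≠ b' := fun hb => h2 b' (hb ▸ h)
  rw [mat_yBold, e_mul_f, f_mul_e]
  ext d
  by_cases hd : d = b'
  · subst hd
    simp [f, h1, h2, h4.symm, -Sum.exists]
  · by_cases hd' : d = b
    · subst hd'
      simp [f, h, h4, h4.symm]
    · simp [f, h3, hd, Ne.symm hd, hd']

open Classical in
theorem vecMul_yBold_fixed (c : ℂˣ) (h1 : ∀ d, ¬ arrow i b d) (h2 : ∀ d, ¬ arrow i d b) :
    Pi.single b 1 ᵥ* mat (yBold i c) = Pi.single b 1 := by
  rw [mat_yBold, e_mul_f, f_mul_e]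
  ext d
  by_cases hd : d = b
  · subst hd
    simp [f, h1, h2, -Sum.exists]
  · simp [f, h2, hd, Ne.symm hd]

open Classical in
theorem yBold_mulVec_source (c : ℂˣ) (h : arrow i b b') :
    mat (yBold i c) *ᵥ Pi.single b 1 = (c : ℂ)⁻¹ • Pi.single b 1 + Pi.single b' 1 := by
  have h1 : ∃ d, arrow i b d := ⟨b', h⟩
  have h2 : ∀ d, ¬ arrow i d b := fun d hd => arrow_not_comp i hd h
  have h3 : ∀ d, arrow i b d ↔ d = b' :=
    fun d => ⟨fun hd => arrow_inj_right i hd h, fun hd => hd ▸ h⟩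
  have h4 : b ≠ b' := fun hb => h2 b (hb ▸ h)
  rw [mat_yBold, e_mul_f, f_mul_e]
  ext d
  by_cases hd : d = b
  · subst hd
    simp [f, h1, h2, h4, -Sum.exists]
  · by_cases hd' : d = b'
    · subst hd'
      simp [f, h, h4.symm]
    · simp [f, h3, hd, hd']

open Classical in
theorem yBold_mulVec_target (c : ℂˣ) (h : arrow i b b') :
    mat (yBold i c) *ᵥ Pi.single b' 1 = (c : ℂ) • Pi.single b' 1 := by
  have h1 : ∃ d, arrow i d b' := ⟨b, h⟩
  have h2 : ∀ d, ¬ arrow i b' d := fun d hd => arrow_not_comp i h hd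
  rw [mat_yBold, e_mul_f, f_mul_e]
  ext d
  by_cases hd : d = b'
  · subst hd
    simp [f, h1, h2, -Sum.exists]
  · simp [f, h2, hd]

open Classical in
theorem yBold_mulVec_fixed (c : ℂˣ) (h1 : ∀ d, ¬ arrow i b d) (h2 : ∀ d, ¬ arrow i d b) :
    mat (yBold i c) *ᵥ Pi.single b 1 = Pi.single b 1 := by
  rw [mat_yBold, e_mul_f, f_mul_e]
  ext d
  by_cases hd : d = b
  · subst hd
    simp [f, h1, h2, -Sum.exists]
  · simp [f, h1, hd, -Sum.exists]

open Classical in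
theorem vecMul_sBar_source (h : arrow i b b') :
    Pi.single b 1 ᵥ* mat (sBar i) = -(Pi.single b' 1 : Basis n → ℂ) := by
  have h1 : ∃ d, arrow i b d := ⟨b', h⟩
  have h2 : ∀ d, ¬ arrow i d b := fun d hd => arrow_not_comp i hd h
  have h3 : ∀ d, arrow i b d ↔ d = b' :=
    fun d => ⟨fun hd => arrow_inj_right i hd h, fun hd => hd ▸ h⟩
  have h4 : b ≠ b' := fun hb => h2 b (hb ▸ h)
  rw [mat_sBar, e_mul_f, f_mul_e]
  ext d
  by_cases hd : d = b
  · subst hd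
    simp [f, e, h1, h2, h4, -Sum.exists]
  · by_cases hd' : d = b'
    · subst hd'
      simp [f, e, h, h2, h4]
    · simp [f, e, h2, h3, Ne.symm hd, hd']

open Classical in
theorem vecMul_sBar_target (h : arrow i b b') :
    Pi.single b' 1 ᵥ* mat (sBar i) = (Pi.single b 1 : Basis n → ℂ) := by
  have h1 : ∃ d, arrow i d b' := ⟨b, h⟩
  have h2 : ∀ d, ¬ arrow i b' d := fun d hd => arrow_not_comp i h hd
  have h3 : ∀ d, arrow i d b' ↔ d = b :=
    fun d => ⟨fun hd => arrow_inj_left i hd h, fun hd => hd ▸ h⟩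
  have h4 : b ≠ b' := fun hb => h2 b' (hb ▸ h)
  rw [mat_sBar, e_mul_f, f_mul_e]
  ext d
  by_cases hd : d = b'
  · subst hd
    simp [f, e, h1, h2, h4.symm, -Sum.exists]
  · by_cases hd' : d = b
    · subst hd'
      simp [f, e, h, h2, h4.symm]
    · simp [f, e, h2, h3, Ne.symm hd, hd']

open Classical in
theorem vecMul_sBar_fixed (h1 : ∀ d, ¬ arrow i b d) (h2 : ∀ d, ¬ arrow i d b) :
    Pi.single b 1 ᵥ* mat (sBar i) = (Pi.single b 1 : Basis n → ℂ) := by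
  rw [mat_sBar, e_mul_f, f_mul_e]
  ext d
  by_cases hd : d = b
  · subst hd
    simp [f, e, h1, h2, -Sum.exists]
  · simp [f, e, h1, h2, hd, Ne.symm hd, -Sum.exists]

end Arrows

/-! ### Coordinate vectors of the vector representation. -/

/-- The coordinate vector of `v_a`, and zero when `a ∉ {1, …, n}`. -/
def vVec (n a : ℕ) : Basis n → ℂ
  | .inl (.inl d) => if d.1 = a then 1 else 0
  | _ => 0

/-- The coordinate vector of `v_{\bar a}`, and zero when `a ∉ {1, …, n}`. -/
def wVec (n a : ℕ) : Basis n → ℂ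
  | .inl (.inr d) => if d.1 = a then 1 else 0
  | _ => 0

section Vectors

variable {n : ℕ}

theorem vVec_eq_single [DecidableEq (Basis n)] (a : Idx n) :
    vVec n a.1 = Pi.single (.inl (.inl a)) 1 := by
  ext ((d | d) | d) <;> simp [vVec, Pi.single_apply]

theorem wVec_eq_single [DecidableEq (Basis n)] (a : Idx n) :
    wVec n a.1 = Pi.single (.inl (.inr a)) 1 := by
  ext ((d | d) | d) <;> simp [wVec, Pi.single_apply]

theorem vVec_eq_zero {a : ℕ} (h : a ∉ Finset.Icc 1 n) : vVec n a = 0 := by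
  ext ((d | d) | d) <;> simp only [vVec, Pi.zero_apply, ite_eq_right_iff]
  rintro rfl
  exact absurd d.2 h

theorem wVec_eq_zero {a : ℕ} (h : a ∉ Finset.Icc 1 n) : wVec n a = 0 := by
  ext ((d | d) | d) <;> simp only [wVec, Pi.zero_apply, ite_eq_right_iff]
  rintro rfl
  exact absurd d.2 h

theorem wVec_dotProduct_vVec (a b : ℕ) : wVec n a ⬝ᵥ vVec n b = 0 := by
  refine Finset.sum_eq_zero fun d _ => ?_
  rcases d with (d | d) | d <;> simp [wVec, vVec]

theorem vVec_dotProduct_vVec_self (a : Idx n) : vVec n a.1 ⬝ᵥ vVec n a.1 = 1 := by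
  classical
  rw [vVec_eq_single]
  simp

theorem vVec_dotProduct_vVec_of_ne {a b : ℕ} (h : a ≠ b) : vVec n a ⬝ᵥ vVec n b = 0 := by
  refine Finset.sum_eq_zero fun d _ => ?_
  rcases d with (d | d) | d <;> simp [vVec]
  rintro rfl
  exact h.symm

theorem arrow_vVec (i : Idx n) {a : Idx n} (hi : i.1 < n) (ha : a.1 = i.1 + 1) :
    arrow i (.inl (.inl i)) (.inl (.inl a)) := ⟨hi, rfl, ha⟩

theorem arrow_wVec (i : Idx n) {a : Idx n} (hi : i.1 < n) (ha : a.1 = i.1 + 1) :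
    arrow i (.inl (.inr a)) (.inl (.inr i)) := ⟨hi, ha, rfl⟩

/-- `i` acts trivially at index `a`: neither `f_i` nor `e_i` moves `v_a` or `v_{\bar a}`. -/
def Far (i : Idx n) (a : ℕ) : Prop :=
  (i.1 < n ∧ a ≠ i.1 ∧ a ≠ i.1 + 1) ∨ (i.1 = n ∧ a + 1 < n)

theorem Far.not_arrow_vVec {i : Idx n} {a : Idx n} (h : Far i a.1) (d : Basis n) :
    ¬ arrow i (.inl (.inl a)) d ∧ ¬ arrow i d (.inl (.inl a)) := by
  unfold Far at h
  rcases d with (d | d) | d <;> simp only [arrow, vecArrow] <;> constructor <;>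
    first | exact id | omega

theorem Far.not_arrow_wVec {i : Idx n} {a : Idx n} (h : Far i a.1) (d : Basis n) :
    ¬ arrow i (.inl (.inr a)) d ∧ ¬ arrow i d (.inl (.inr a)) := by
  unfold Far at h
  rcases d with (d | d) | d <;> simp only [arrow, vecArrow] <;> constructor <;>
    first | exact id | omega

theorem wVec_yBold_far {i : Idx n} {a : ℕ} (c : ℂˣ) (h : Far i a) :
    wVec n a ᵥ* mat (yBold i c) = wVec n a := by
  classical
  by_cases ha : a ∈ Finset.Icc 1 n
  · have := vecMul_yBold_fixed (b := .inl (.inr (⟨a, ha⟩ : Idx n))) c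
      (fun d => (Far.not_arrow_wVec h d).1) (fun d => (Far.not_arrow_wVec h d).2)
    rwa [← wVec_eq_single] at this
  · rw [wVec_eq_zero ha, zero_vecMul]

theorem yBold_vVec_far {i : Idx n} {a : ℕ} (c : ℂˣ) (h : Far i a) :
    mat (yBold i c) *ᵥ vVec n a = vVec n a := by
  classical
  by_cases ha : a ∈ Finset.Icc 1 n
  · have := yBold_mulVec_fixed (b := .inl (.inl (⟨a, ha⟩ : Idx n))) c
      (fun d => (Far.not_arrow_vVec h d).1) (fun d => (Far.not_arrow_vVec h d).2)
    rwa [← vVec_eq_single] at this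
  · rw [vVec_eq_zero ha, mulVec_zero]

theorem wVec_sBar_far {i : Idx n} {a : ℕ} (h : Far i a) :
    wVec n a ᵥ* mat (sBar i) = wVec n a := by
  classical
  by_cases ha : a ∈ Finset.Icc 1 n
  · have := vecMul_sBar_fixed (b := .inl (.inr (⟨a, ha⟩ : Idx n)))
      (fun d => (Far.not_arrow_wVec h d).1) (fun d => (Far.not_arrow_wVec h d).2)
    rwa [← wVec_eq_single] at this
  · rw [wVec_eq_zero ha, zero_vecMul]

theorem vVec_sBar_far {i : Idx n} {a : ℕ} (h : Far i a) :
    vVec n a ᵥ* mat (sBar i) = vVec n a := by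
  classical
  by_cases ha : a ∈ Finset.Icc 1 n
  · have := vecMul_sBar_fixed (b := .inl (.inl (⟨a, ha⟩ : Idx n)))
      (fun d => (Far.not_arrow_vVec h d).1) (fun d => (Far.not_arrow_vVec h d).2)
    rwa [← vVec_eq_single] at this
  · rw [vVec_eq_zero ha, zero_vecMul]

theorem succ_mem {i : Idx n} (hi : i.1 < n) : i.1 + 1 ∈ Finset.Icc 1 n :=
  Finset.mem_Icc.mpr ⟨by omega, hi⟩

theorem wVec_yBold_self {i : Idx n} (c : ℂˣ) (hi : i.1 < n) :
    wVec n i.1 ᵥ* mat (yBold i c) = (c : ℂ) • wVec n i.1 + wVec n (i.1 + 1) := by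
  classical
  have := vecMul_yBold_target c (arrow_wVec i (a := ⟨i.1 + 1, succ_mem hi⟩) hi rfl)
  rwa [← wVec_eq_single, ← wVec_eq_single] at this

theorem wVec_yBold_succ {i : Idx n} (c : ℂˣ) (hi : i.1 < n) :
    wVec n (i.1 + 1) ᵥ* mat (yBold i c) = (c : ℂ)⁻¹ • wVec n (i.1 + 1) := by
  classical
  have := vecMul_yBold_source c (arrow_wVec i (a := ⟨i.1 + 1, succ_mem hi⟩) hi rfl)
  rwa [← wVec_eq_single] at this

theorem yBold_vVec_self {i : Idx n} (c : ℂˣ) (hi : i.1 < n) :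
    mat (yBold i c) *ᵥ vVec n i.1 = (c : ℂ)⁻¹ • vVec n i.1 + vVec n (i.1 + 1) := by
  classical
  have := yBold_mulVec_source c (arrow_vVec i (a := ⟨i.1 + 1, succ_mem hi⟩) hi rfl)
  rwa [← vVec_eq_single, ← vVec_eq_single] at this

theorem yBold_vVec_succ {i : Idx n} (c : ℂˣ) (hi : i.1 < n) :
    mat (yBold i c) *ᵥ vVec n (i.1 + 1) = (c : ℂ) • vVec n (i.1 + 1) := by
  classical
  have := yBold_mulVec_target c (arrow_vVec i (a := ⟨i.1 + 1, succ_mem hi⟩) hi rfl)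
  rwa [← vVec_eq_single] at this

theorem wVec_sBar_self {i : Idx n} (hi : i.1 < n) :
    wVec n i.1 ᵥ* mat (sBar i) = wVec n (i.1 + 1) := by
  classical
  have := vecMul_sBar_target (arrow_wVec i (a := ⟨i.1 + 1, succ_mem hi⟩) hi rfl)
  rwa [← wVec_eq_single, ← wVec_eq_single] at this

theorem wVec_sBar_succ {i : Idx n} (hi : i.1 < n) :
    wVec n (i.1 + 1) ᵥ* mat (sBar i) = -wVec n i.1 := by
  classical
  have := vecMul_sBar_source (arrow_wVec i (a := ⟨i.1 + 1, succ_mem hi⟩) hi rfl)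
  rwa [← wVec_eq_single, ← wVec_eq_single] at this

theorem vVec_sBar_self {i : Idx n} (hi : i.1 < n) :
    vVec n i.1 ᵥ* mat (sBar i) = -vVec n (i.1 + 1) := by
  classical
  have := vecMul_sBar_source (arrow_vVec i (a := ⟨i.1 + 1, succ_mem hi⟩) hi rfl)
  rwa [← vVec_eq_single, ← vVec_eq_single] at this

theorem vVec_sBar_succ {i : Idx n} (hi : i.1 < n) :
    vVec n (i.1 + 1) ᵥ* mat (sBar i) = vVec n i.1 := by
  classical
  have := vecMul_sBar_target (arrow_vVec i (a := ⟨i.1 + 1, succ_mem hi⟩) hi rfl)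
  rwa [← vVec_eq_single, ← vVec_eq_single] at this

theorem arrow_last {i a b : Idx n} (hi : i.1 = n)
    (h : (a.1 + 1 = n ∧ b.1 = n) ∨ (a.1 = n ∧ b.1 + 1 = n)) :
    arrow i (.inl (.inl a)) (.inl (.inr b)) := ⟨hi, h⟩

theorem wVec_yBold_last {i a b : Idx n} (c : ℂˣ) (hi : i.1 = n)
    (h : (a.1 + 1 = n ∧ b.1 = n) ∨ (a.1 = n ∧ b.1 + 1 = n)) :
    wVec n b.1 ᵥ* mat (yBold i c) = (c : ℂ) • wVec n b.1 + vVec n a.1 := by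
  classical
  have := vecMul_yBold_target c (arrow_last hi h)
  rwa [← vVec_eq_single, ← wVec_eq_single] at this

theorem wVec_sBar_last {i a b : Idx n} (hi : i.1 = n)
    (h : (a.1 + 1 = n ∧ b.1 = n) ∨ (a.1 = n ∧ b.1 + 1 = n)) :
    wVec n b.1 ᵥ* mat (sBar i) = vVec n a.1 := by
  classical
  have := vecMul_sBar_target (arrow_last hi h)
  rwa [← vVec_eq_single, ← wVec_eq_single] at this

end Vectors

/-! ### One cycle, and products of the last cycles. -/

section Cycles

variable {n : ℕ}

theorem vecMul_mat_prod_ofFn {m : ℕ} (g : Fin m → G n) (F : ℕ → Basis n → ℂ)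
    (h : ∀ i : Fin m, F i.1 ᵥ* mat (g i) = F (i.1 + 1)) :
    F 0 ᵥ* mat (List.ofFn g).prod = F m := by
  induction m generalizing F with
  | zero => simp [mat_one]
  | succ m ih =>
    rw [List.ofFn_succ, List.prod_cons, mat_mul, ← vecMul_vecMul]
    have h0 := h 0
    rw [Fin.val_zero] at h0
    rw [h0]
    exact ih (fun i => g i.succ) (fun k => F (k + 1)) fun i => h i.succ

theorem mat_prod_ofFn_mulVec {m : ℕ} (g : Fin m → G n) (F : ℕ → Basis n → ℂ)
    (h : ∀ i : Fin m, mat (g i) *ᵥ F (i.1 + 1) = F i.1) :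
    mat (List.ofFn g).prod *ᵥ F m = F 0 := by
  induction m generalizing F with
  | zero => simp [mat_one]
  | succ m ih =>
    rw [List.ofFn_succ, List.prod_cons, mat_mul, ← mulVec_mulVec]
    have := ih (fun i => g i.succ) (fun k => F (k + 1)) fun i => h i.succ
    rw [this]
    exact h 0

/-- Row vectors `F 0, …, F n` with `F (i - 1) g_i = F i` satisfy `F 0 (g_1 ⋯ g_n) = F n`. -/
theorem vecMul_mat_cycle (g : Idx n → G n) (F : ℕ → Basis n → ℂ)
    (h : ∀ i : Idx n, F (i.1 - 1) ᵥ* mat (g i) = F i.1) :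
    F 0 ᵥ* mat ((cycleWord n).map g).prod = F n := by
  rw [cycleWord, List.map_ofFn]
  exact vecMul_mat_prod_ofFn _ F fun i =>
    h ⟨i.1 + 1, Finset.mem_Icc.mpr ⟨by omega, by omega⟩⟩

theorem mat_cycle_mulVec (g : Idx n → G n) (F : ℕ → Basis n → ℂ)
    (h : ∀ i : Idx n, mat (g i) *ᵥ F i.1 = F (i.1 - 1)) :
    mat ((cycleWord n).map g).prod *ᵥ F n = F 0 := by
  rw [cycleWord, List.map_ofFn]
  exact mat_prod_ofFn_mulVec _ F fun i =>
    h ⟨i.1 + 1, Finset.mem_Icc.mpr ⟨by omega, by omega⟩⟩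

/-- `𝐲_1(c_1) ⋯ 𝐲_n(c_n)`. -/
noncomputable def cycle (n : ℕ) (c : ℕ → ℂˣ) : G n :=
  ((cycleWord n).map fun i => yBold i (c i.1)).prod

/-- The parameter `c_i`, with the convention `c_0 = 1`. -/
noncomputable def param (c : ℕ → ℂˣ) (i : ℕ) : ℂ := if i = 0 then 1 else c i

theorem param_ne_zero (c : ℕ → ℂˣ) (i : ℕ) : param c i ≠ 0 := by
  unfold param; split_ifs <;> simp

theorem param_of_pos (c : ℕ → ℂˣ) {i : ℕ} (h : 1 ≤ i) : param c i = c i :=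
  if_neg (by omega)

theorem Idx.one_le (i : Idx n) : 1 ≤ i.1 := (Finset.mem_Icc.mp i.2).1

theorem Idx.le (i : Idx n) : i.1 ≤ n := (Finset.mem_Icc.mp i.2).2

/-- The difference is chosen so that the factor `r + 1` cancels `w_{r+2}`, before any later factor
can move it. The bound on `r` keeps the factor `n` from acting on `w_{r+1}`. -/
theorem wVec_cycle (c : ℕ → ℂˣ) (r : ℕ) (hr : r + 3 ≤ n) :
    (param c r • wVec n (r + 1) - param c (r + 1) • wVec n (r + 2)) ᵥ* mat (cycle n c) =
      param c (r + 1) • wVec n (r + 1) := by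
  have key := vecMul_mat_cycle (fun i : Idx n => yBold i (c i.1))
    -- The value at `h` is the row vector after the first `h` factors; only the factors `r` and `r +
    -- 1` change it.
    (fun h => if h < r then param c r • wVec n (r + 1) - param c (r + 1) • wVec n (r + 2)
      else if h = r then wVec n (r + 1) - param c (r + 1) • wVec n (r + 2)
      else param c (r + 1) • wVec n (r + 1)) ?_
  · rw [if_neg (by omega : ¬ n < r), if_neg (by omega : ¬ n = r)] at key
    rw [cycle, ← key]
    congr 1
    by_cases h : r = 0
    -- For `r = 0` there is no factor `r` to remove a scalar; the convention `c_0 = 1` makes the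
    -- formula agree.
    · subst h; simp [param]
    · rw [if_pos (by omega)]
  · intro i
    have hi := i.one_le
    have hi' := i.le
    rcases lt_trichotomy i.1 r with h | h | h
    · rw [if_pos (by omega), if_pos h, sub_vecMul, smul_vecMul, smul_vecMul,
        wVec_yBold_far _ (Or.inl (by omega)), wVec_yBold_far _ (Or.inl (by omega))]
    · obtain rfl := h
      rw [if_pos (by omega), if_neg (by omega), if_pos rfl, sub_vecMul, smul_vecMul, smul_vecMul,
        wVec_yBold_succ _ (by omega), wVec_yBold_far (a := i.1 + 2) _ (Or.inl (by omega)),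
        param_of_pos c hi, smul_inv_smul₀ (c i.1).ne_zero]
    · by_cases h1 : i.1 = r + 1
      · obtain rfl : r = i.1 - 1 := by omega
        have h2 : i.1 - 1 + 1 = i.1 := by omega
        have h3 : i.1 - 1 + 2 = i.1 + 1 := by omega
        rw [if_neg (by omega), if_pos rfl, if_neg (by omega), if_neg (by omega), sub_vecMul,
          smul_vecMul, h2, h3, wVec_yBold_self _ (by omega), wVec_yBold_succ _ (by omega),
          param_of_pos c hi, smul_inv_smul₀ (c i.1).ne_zero, add_sub_cancel_right]
      · rw [if_neg (by omega), if_neg (by omega), if_neg (by omega), if_neg (by omega),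
          smul_vecMul, wVec_yBold_far]
        unfold Far
        omega

/-- At the index `n - 1` the factor `n` acts as well. The path `w_{n-1} → w_n → v_{n-1}` through the
factors `n - 1` and `n` is the only one ending in `v_{n-1}`, and both steps have coefficient `1`. -/
theorem wVec_cycle_last (c : ℕ → ℂˣ) (q : ℕ) (hq : q + 2 = n) :
    param c q * (wVec n (q + 1) ᵥ* mat (cycle n c) ⬝ᵥ vVec n (q + 1)) = 1 := by
  have key := vecMul_mat_cycle (fun i : Idx n => yBold i (c i.1))
    (fun h => if h < q then param c q • wVec n (q + 1)
      else if h = q then wVec n (q + 1)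
      else if h = q + 1 then (c (q + 1) : ℂ) • wVec n (q + 1) + wVec n n
      else (c (q + 1) : ℂ) • ((c n : ℂ) • wVec n (q + 1) + vVec n n) +
        ((c n : ℂ) • wVec n n + vVec n (q + 1))) ?_
  · rw [if_neg (by omega : ¬ n < q), if_neg (by omega : ¬ n = q),
      if_neg (by omega : ¬ n = q + 1)] at key
    have h0 : (if 0 < q then param c q • wVec n (q + 1)
      else if 0 = q then wVec n (q + 1)
      else if 0 = q + 1 then (c (q + 1) : ℂ) • wVec n (q + 1) + wVec n n
      else (c (q + 1) : ℂ) • ((c n : ℂ) • wVec n (q + 1) + vVec n n) +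
        ((c n : ℂ) • wVec n n + vVec n (q + 1))) = param c q • wVec n (q + 1) := by
      by_cases h : q = 0
      · subst h; simp [param]
      · rw [if_pos (by omega)]
    rw [h0] at key
    rw [← smul_eq_mul, ← smul_dotProduct, ← smul_vecMul, cycle, key]
    have h1 := vVec_dotProduct_vVec_self
      (⟨q + 1, Finset.mem_Icc.mpr ⟨by omega, by omega⟩⟩ : Idx n)
    have h2 := vVec_dotProduct_vVec_of_ne (n := n) (a := n) (b := q + 1) (by omega)
    simp only at h1
    simp only [add_dotProduct, smul_dotProduct, wVec_dotProduct_vVec, h1, h2]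
    simp
  · intro i
    have hi := i.one_le
    have hi' := i.le
    rcases lt_trichotomy i.1 q with h | h | h
    · rw [if_pos (by omega), if_pos h, smul_vecMul, wVec_yBold_far _ (Or.inl (by omega))]
    · obtain rfl := h
      rw [if_pos (by omega), if_neg (by omega), if_pos rfl, smul_vecMul,
        wVec_yBold_succ _ (by omega), param_of_pos c hi, smul_inv_smul₀ (c i.1).ne_zero]
    · by_cases h1 : i.1 = q + 1
      · have h2 : i.1 + 1 = n := by omega
        rw [if_neg (by omega), if_pos (by omega), if_neg (by omega), if_neg (by omega), if_pos h1,
          ← h1, wVec_yBold_self _ (by omega), h2]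
      · have h2 : i.1 = n := by omega
        have h3 := wVec_yBold_last (i := i) (a := i)
          (b := ⟨q + 1, Finset.mem_Icc.mpr ⟨by omega, by omega⟩⟩) (c i.1) h2
          (Or.inr ⟨h2, by simp only; omega⟩)
        have h4 := wVec_yBold_last (i := i) (b := i)
          (a := ⟨q + 1, Finset.mem_Icc.mpr ⟨by omega, by omega⟩⟩) (c i.1) h2
          (Or.inl ⟨by simp only; omega, h2⟩)
        simp only [h2] at h3 h4
        rw [if_neg (by omega), if_neg (by omega), if_pos (by omega), if_neg (by omega),
          if_neg (by omega), if_neg (by omega), add_vecMul, smul_vecMul, h2, h3, h4]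

/-- On columns the factors act from the last to the first: `r + 1` creates `v_{r+2}`, and `r` only
rescales `v_{r+1}`. The coefficient `1` of `v_{r+2}` is what makes the leading terms below monic. -/
theorem cycle_vVec (c : ℕ → ℂˣ) (r : ℕ) (hr : r + 3 ≤ n) :
    mat (cycle n c) *ᵥ vVec n (r + 1) =
      ((c (r + 1) : ℂ)⁻¹ * param c r) • vVec n (r + 1) + vVec n (r + 2) := by
  have key := mat_cycle_mulVec (fun i : Idx n => yBold i (c i.1))
    (fun h => if h < r then ((c (r + 1) : ℂ)⁻¹ * param c r) • vVec n (r + 1) + vVec n (r + 2)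
      else if h = r then (c (r + 1) : ℂ)⁻¹ • vVec n (r + 1) + vVec n (r + 2)
      else vVec n (r + 1)) ?_
  · rw [if_neg (by omega : ¬ n < r), if_neg (by omega : ¬ n = r)] at key
    rw [cycle, key]
    by_cases h : r = 0
    · subst h; simp [param]
    · rw [if_pos (by omega)]
  · intro i
    have hi := i.one_le
    have hi' := i.le
    rcases lt_trichotomy i.1 r with h | h | h
    · rw [if_pos (by omega), if_pos (by omega), mulVec_add, mulVec_smul,
        yBold_vVec_far _ (Or.inl (by omega)), yBold_vVec_far _ (Or.inl (by omega))]
    · obtain rfl := h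
      rw [if_neg (by omega), if_pos rfl, if_pos (by omega), mulVec_add, mulVec_smul,
        yBold_vVec_succ _ (by omega), yBold_vVec_far (a := i.1 + 2) _ (Or.inl (by omega)),
        param_of_pos c hi, smul_smul]
    · by_cases h1 : i.1 = r + 1
      · obtain rfl : r = i.1 - 1 := by omega
        have h2 : i.1 - 1 + 1 = i.1 := by omega
        have h3 : i.1 - 1 + 2 = i.1 + 1 := by omega
        rw [if_neg (by omega), if_neg (by omega), if_neg (by omega), if_pos rfl, h2, h3,
          yBold_vVec_self _ (by omega)]
      · rw [if_neg (by omega), if_neg (by omega), if_neg (by omega), if_neg (by omega),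
          yBold_vVec_far]
        unfold Far
        omega

/-- The span of `v_1, …, v_m`. -/
def headSpan (n m : ℕ) : Submodule ℂ (Basis n → ℂ) :=
  Submodule.span ℂ {v | ∃ a, 1 ≤ a ∧ a ≤ m ∧ v = vVec n a}

theorem vVec_mem_headSpan {a m : ℕ} (h1 : 1 ≤ a) (h : a ≤ m) : vVec n a ∈ headSpan n m :=
  Submodule.subset_span ⟨a, h1, h, rfl⟩

theorem wVec_dotProduct_of_mem_headSpan {m : ℕ} {v : Basis n → ℂ} (hv : v ∈ headSpan n m)
    (r : ℕ) : wVec n r ⬝ᵥ v = 0 := by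
  induction hv using Submodule.span_induction with
  | mem v hv => obtain ⟨a, -, -, rfl⟩ := hv; exact wVec_dotProduct_vVec r a
  | zero => simp
  | add v w _ _ hv hw => rw [dotProduct_add, hv, hw, add_zero]
  | smul t v _ hv => rw [dotProduct_smul, hv, smul_zero]

theorem cycle_mem_headSpan (c : ℕ → ℂˣ) {m : ℕ} (hm : m + 2 ≤ n) {v : Basis n → ℂ}
    (hv : v ∈ headSpan n m) : mat (cycle n c) *ᵥ v ∈ headSpan n (m + 1) := by
  induction hv using Submodule.span_induction with
  | mem v hv =>
    obtain ⟨a, ha, ham, rfl⟩ := hv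
    obtain ⟨r, rfl⟩ : ∃ r, a = r + 1 := ⟨a - 1, by omega⟩
    rw [cycle_vVec c r (by omega)]
    exact add_mem (Submodule.smul_mem _ _ (vVec_mem_headSpan ha (by omega)))
      (vVec_mem_headSpan (by omega) (by omega))
  | zero => simp
  | add v w _ _ hv hw => rw [mulVec_add]; exact add_mem hv hw
  | smul t v _ hv => rw [mulVec_smul]; exact Submodule.smul_mem _ _ hv

/-- The product of the cycles number `j + 1, …, n - 1` in `Θ(c)`. -/
noncomputable def tailΘ (n : ℕ) (c : ℕ → ℕ → ℂˣ) (j : ℕ) : G n :=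
  ((List.ofFn fun p : Fin (n - 1) => cycle n (c (p.1 + 1))).drop j).prod

theorem tailΘ_zero (c : ℕ → ℕ → ℂˣ) : tailΘ n c 0 = Θ n c := rfl

theorem tailΘ_eq_mul (c : ℕ → ℕ → ℂˣ) {j : ℕ} (hj : j + 2 ≤ n) :
    tailΘ n c j = cycle n (c (j + 1)) * tailΘ n c (j + 1) := by
  rw [tailΘ, List.drop_eq_getElem_cons (by rw [List.length_ofFn]; omega), List.prod_cons,
    List.getElem_ofFn]
  rfl

/-- The last `t` cycles shift the leading index by `t`, with leading coefficient `1`, as long as the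
index stays at most `n - 1`. -/
theorem tailΘ_vVec (c : ℕ → ℕ → ℂˣ) (t : ℕ) : ∀ s, 1 ≤ s → s + t + 1 ≤ n →
    mat (tailΘ n c (n - 1 - t)) *ᵥ vVec n s - vVec n (s + t) ∈ headSpan n (s + t - 1) := by
  induction t with
  | zero =>
    intro s _ _
    have : tailΘ n c (n - 1 - 0) = 1 := by
      rw [tailΘ, List.drop_eq_nil_of_le (by rw [List.length_ofFn]; omega), List.prod_nil]
    rw [this, mat_one, one_mulVec, add_zero, sub_self]
    exact zero_mem _
  | succ t ih =>
    intro s hs hst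
    have h1 : n - 1 - (t + 1) + 1 = n - 1 - t := by omega
    rw [tailΘ_eq_mul c (by omega), h1, mat_mul, ← mulVec_mulVec]
    have h2 := cycle_mem_headSpan (c (n - 1 - t)) (by omega) (ih s hs (by omega))
    obtain ⟨r, hr⟩ : ∃ r, s + t = r + 1 := ⟨s + t - 1, by omega⟩
    have h3 : s + (t + 1) = r + 2 := by omega
    have h4 : r + 2 - 1 = r + 1 := by omega
    have h5 : r + 1 - 1 + 1 = r + 1 := by omega
    rw [hr, mulVec_sub, cycle_vVec _ r (by omega), h5] at h2
    rw [h3, h4]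
    have h6 := add_mem h2 (Submodule.smul_mem _
      (((c (n - 1 - t)) (r + 1) : ℂ)⁻¹ * param (c (n - 1 - t)) r)
      (vVec_mem_headSpan (n := n) (m := r + 1) (a := r + 1) (by omega) le_rfl))
    convert h6 using 1
    abel

/-- Pairing `wVec_cycle` with `v_{n-1}` kills its right side, so the quantity does not depend on
`r`; `wVec_cycle_last` gives its value at `r = n - 2`. -/
theorem wVec_cycle_vVec_last (c : ℕ → ℂˣ) (t : ℕ) : ∀ r, r + t + 2 = n →
    param c r * (wVec n (r + 1) ᵥ* mat (cycle n c) ⬝ᵥ vVec n (n - 1)) = 1 := by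
  induction t with
  | zero =>
    intro r hr
    have : n - 1 = r + 1 := by omega
    rw [this]
    exact wVec_cycle_last c r hr
  | succ t ih =>
    intro r hr
    have h1 := congrArg (· ⬝ᵥ vVec n (n - 1)) (wVec_cycle c r (by omega))
    simp only [sub_vecMul, smul_vecMul, sub_dotProduct, smul_dotProduct, wVec_dotProduct_vVec,
      smul_eq_mul, mul_zero] at h1
    rw [sub_eq_zero.mp h1]
    exact ih (r + 1) (by omega)

/-- `step` is the row identity for one cycle. The other two relations come from columns: for `s ≤ j`
the remaining cycles keep `v_s` in the span of `v_1, …, v_{n-1}`, which every `w_r` annihilates, and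
`s = j + 1` is the first column to leave it. -/
theorem entryRecursion (c : ℕ → ℕ → ℂˣ) :
    EntryRecursion n (fun j i => param (c (j + 1)) i)
      fun j r s => wVec n r ⬝ᵥ mat (tailΘ n c j) *ᵥ vVec n s where
  ne_zero j i := param_ne_zero _ _
  zero j := if_pos rfl
  step j r s hj hr := by
    have h1 := congrArg (· ⬝ᵥ mat (tailΘ n c (j + 1)) *ᵥ vVec n s) (wVec_cycle (c (j + 1)) r hr)
    simp only [← dotProduct_mulVec, mulVec_mulVec, ← mat_mul] at h1
    rw [← tailΘ_eq_mul c hj] at h1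
    simp only [sub_dotProduct, smul_dotProduct, smul_eq_mul] at h1
    linear_combination h1
  vanish j r s hj hr hs hsj := by
    have h1 := tailΘ_vVec (n := n) c (n - 1 - j) s hs (by omega)
    have h2 : n - 1 - (n - 1 - j) = j := by omega
    have h3 := wVec_dotProduct_of_mem_headSpan h1 r
    rw [h2, dotProduct_sub, wVec_dotProduct_vVec, sub_zero] at h3
    exact h3
  first j r hj hr := by
    -- All cycles but the first of the tail bring `v_{j+1}` to `v_{n-1}` plus lower terms. One more
    -- cycle keeps the lower terms in the span of `v_1, …, v_{n-1}`, so only `v_{n-1}` contributes.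
    have h1 := tailΘ_vVec (n := n) c (n - 2 - j) (j + 1) (by omega) (by omega)
    have h2 : n - 1 - (n - 2 - j) = j + 1 := by omega
    have h3 : j + 1 + (n - 2 - j) = n - 1 := by omega
    rw [h2, h3] at h1
    have h4 := wVec_dotProduct_of_mem_headSpan
      (cycle_mem_headSpan (c (j + 1)) (by omega) h1) (r + 1)
    rw [mulVec_sub, dotProduct_sub, mulVec_mulVec, ← mat_mul, ← tailΘ_eq_mul c hj,
      sub_eq_zero] at h4
    rw [h4, dotProduct_mulVec]
    exact wVec_cycle_vVec_last _ (n - 2 - r) r (by omega)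

end Cycles

/-! ### The representative of the longest element. -/

section LongestElement

variable {n : ℕ}

theorem wVec_sBar_cycle_one (hn : 2 ≤ n) :
    wVec n 1 ᵥ* mat ((cycleWord n).map sBar).prod = vVec n (n - 1) := by
  have key := vecMul_mat_cycle (n := n) sBar
    (fun h => if h < n then wVec n (h + 1) else vVec n (n - 1)) ?_
  · simpa [show 0 < n by omega] using key
  · intro i
    have hi := i.one_le
    have hi' := i.le
    have h1 : i.1 - 1 + 1 = i.1 := by omega
    rw [if_pos (by omega), h1]
    by_cases h : i.1 < n
    · rw [if_pos h, wVec_sBar_self h]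
    · rw [if_neg h]
      exact wVec_sBar_last (a := ⟨n - 1, Finset.mem_Icc.mpr ⟨by omega, by omega⟩⟩) (by omega)
        (Or.inl ⟨by simp only; omega, by omega⟩)

theorem wVec_sBar_cycle (a : ℕ) (ha : 1 ≤ a) (han : a + 2 ≤ n) :
    wVec n (a + 1) ᵥ* mat ((cycleWord n).map sBar).prod = -wVec n a := by
  have key := vecMul_mat_cycle (n := n) sBar
    (fun h => if h < a then wVec n (a + 1) else -wVec n a) ?_
  · simpa [show 0 < a by omega, show ¬ n < a by omega] using key
  · intro i
    have hi := i.one_le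
    have hi' := i.le
    rcases lt_trichotomy i.1 a with h | h | h
    · rw [if_pos (by omega), if_pos h, wVec_sBar_far (Or.inl (by omega))]
    · obtain rfl := h
      rw [if_pos (by omega), if_neg (by omega), wVec_sBar_succ (by omega)]
    · rw [if_neg (by omega), if_neg (by omega), neg_vecMul, wVec_sBar_far]
      unfold Far
      omega

theorem vVec_sBar_cycle (a : ℕ) (ha : 1 ≤ a) (han : a + 2 ≤ n) :
    vVec n (a + 1) ᵥ* mat ((cycleWord n).map sBar).prod = vVec n a := by
  have key := vecMul_mat_cycle (n := n) sBar
    (fun h => if h < a then vVec n (a + 1) else vVec n a) ?_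
  · simpa [show 0 < a by omega, show ¬ n < a by omega] using key
  · intro i
    have hi := i.one_le
    have hi' := i.le
    rcases lt_trichotomy i.1 a with h | h | h
    · rw [if_pos (by omega), if_pos h, vVec_sBar_far (Or.inl (by omega))]
    · obtain rfl := h
      rw [if_pos (by omega), if_neg (by omega), vVec_sBar_succ (by omega)]
    · rw [if_neg (by omega), if_neg (by omega), vVec_sBar_far]
      unfold Far
      omega

/-- Each Coxeter factor lowers the index of `w` with a sign; after `t` of them `w_1` is reached, and
one more sends it to `v_{n-1}`. -/
theorem wVec_sBar_cycle_pow (t : ℕ) (ht : t + 2 ≤ n) :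
    wVec n (t + 1) ᵥ* mat (((cycleWord n).map sBar).prod ^ (t + 1)) =
      (-1 : ℂ) ^ t • vVec n (n - 1) := by
  induction t with
  | zero => simpa using wVec_sBar_cycle_one (by omega)
  | succ t ih =>
    rw [pow_succ', mat_mul, ← vecMul_vecMul, wVec_sBar_cycle (t + 1) (by omega) (by omega),
      neg_vecMul, ih (by omega), pow_succ]
    module

theorem vVec_sBar_cycle_pow (t : ℕ) : ∀ a, 1 ≤ a → a + t + 1 ≤ n →
    vVec n (a + t) ᵥ* mat (((cycleWord n).map sBar).prod ^ t) = vVec n a := by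
  induction t with
  | zero => intro a _ _; simp [mat_one]
  | succ t ih =>
    intro a ha hat
    rw [pow_succ', mat_mul, ← vecMul_vecMul, ← add_assoc,
      vVec_sBar_cycle (a + t) (by omega) (by omega), ih a ha (by omega)]

theorem wVec_w₀Bar (r : ℕ) (hr : r + 2 ≤ n) :
    wVec n (r + 1) ᵥ* mat (w₀Bar n) = (-1 : ℂ) ^ r • vVec n (r + 1) := by
  -- `r + 1` Coxeter factors lead from `w_{r+1}` to `v_{n-1}`, and the remaining `n - 2 - r` lower
  -- `v_{n-1}` to `v_{r+1}` without signs.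
  have h1 : n - 1 = (r + 1) + (n - 2 - r) := by omega
  rw [w₀Bar]
  conv_lhs => rw [h1, pow_add, mat_mul, ← vecMul_vecMul, wVec_sBar_cycle_pow r hr, smul_vecMul,
    h1, vVec_sBar_cycle_pow (n - 2 - r) (r + 1) (by omega) (by omega)]

theorem vVec_w₀Bar_inv (r : ℕ) (hr : r + 2 ≤ n) :
    vVec n (r + 1) ᵥ* mat (w₀Bar n)⁻¹ = (-1 : ℂ) ^ r • wVec n (r + 1) := by
  have h1 := congrArg (· ᵥ* mat (w₀Bar n)⁻¹) (wVec_w₀Bar r hr)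
  simp only [vecMul_vecMul, ← mat_mul, mul_inv_cancel, mat_one, vecMul_one, smul_vecMul] at h1
  rw [h1, smul_smul, ← mul_pow]
  simp

end LongestElement

/-! ### The generalized minor as an explicit determinant. -/

theorem mat_apply_vVec {n : ℕ} (g : G n) (a b : Idx n) :
    mat g (.inl (.inl a)) (.inl (.inl b)) = vVec n a.1 ⬝ᵥ mat g *ᵥ vVec n b.1 := by
  classical
  rw [vVec_eq_single, vVec_eq_single]
  simp

/-- The index set `{1, …, k}` of the head of the vector representation. -/
def headEquiv {n : ℕ} (k : Idx n) : Fin k.1 ≃ {a : Idx n // a.1 ≤ k.1} where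
  toFun r := ⟨⟨r.1 + 1, Finset.mem_Icc.mpr ⟨by omega, by have := k.le; omega⟩⟩, r.2⟩
  invFun a := ⟨a.1.1 - 1, by have := a.1.one_le; have := a.2; omega⟩
  left_inv r := by simp
  right_inv a := by
    have := a.1.one_le
    exact Subtype.ext (Subtype.ext (by simp only; omega))

theorem principalMinor_eq_det {n : ℕ} (k : Idx n) (g : G n) :
    principalMinor k g =
      det (of fun r s : Fin k.1 => vVec n (r.1 + 1) ⬝ᵥ mat g *ᵥ vVec n (s.1 + 1)) := by
  rw [principalMinor, ← det_submatrix_equiv_self (headEquiv k)]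
  congr 1
  ext r s
  exact mat_apply_vVec g _ _

/-- `\bar s_k` affects only the last row, giving `-v_{k+1}`. Its sign combines with the `(-1)^k` of
`\bar w₀⁻¹` to `(-1)^{k-1}`, so the sign pattern `(-1)^r` holds for all rows. -/
theorem vVec_sBar_mul_w₀Bar_inv {n : ℕ} (k : Idx n) (hk : k.1 + 2 ≤ n) {r : ℕ} (hr : r < k.1) :
    vVec n (r + 1) ᵥ* mat (sBar k * (w₀Bar n)⁻¹) =
      (-1 : ℂ) ^ r • wVec n (if r + 1 = k.1 then r + 2 else r + 1) := by
  rw [mat_mul, ← vecMul_vecMul]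
  by_cases h : r + 1 = k.1
  · rw [if_pos h, h, vVec_sBar_self (by omega), neg_vecMul, ← h, vVec_w₀Bar_inv _ (by omega),
      pow_succ]
    module
  · rw [if_neg h, vVec_sBar_far (Or.inl (by omega)), vVec_w₀Bar_inv _ (by omega)]

theorem generalizedMinor_eq_det {n : ℕ} (k : Idx n) (hk : k.1 + 2 ≤ n) (g : G n) :
    generalizedMinor k (w₀sBar k) 1 g =
      det (of fun r s : Fin k.1 => (-1 : ℂ) ^ r.1 *
        (wVec n (if r.1 + 1 = k.1 then r.1 + 2 else r.1 + 1) ⬝ᵥ mat g *ᵥ vVec n (s.1 + 1))) := by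
  have h1 : (w₀sBar k)⁻¹ * g * 1 = sBar k * (w₀Bar n)⁻¹ * g := by
    rw [w₀sBar, _root_.mul_inv_rev, inv_inv, mul_one]
  rw [generalizedMinor, h1, principalMinor_eq_det]
  congr 1
  ext r s
  rw [of_apply, of_apply, mat_mul, ← mulVec_mulVec, dotProduct_mulVec,
    vVec_sBar_mul_w₀Bar_inv k hk r.2, smul_dotProduct, smul_eq_mul]

end TypeD

theorem mainTheorem10 (n k : ℕ) (hk : 1 ≤ k) (hkn : k ≤ n - 2) (c : ℕ → ℕ → ℂˣ) :
    TypeD.generalizedMinor (⟨k, Finset.mem_Icc.mpr ⟨hk, by omega⟩⟩ : TypeD.Idx n)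
        (TypeD.w₀sBar ⟨k, Finset.mem_Icc.mpr ⟨hk, by omega⟩⟩) 1 (TypeD.Θ n c) =
      1 / (c k 1 : ℂ) +
        ∑ j ∈ Finset.Icc 1 (k - 1), (c j (k - j) : ℂ) / (c j (k - j + 1) : ℂ) := by
  obtain ⟨l, rfl⟩ : ∃ l, k = l + 1 := ⟨k - 1, by omega⟩
  rw [TypeD.generalizedMinor_eq_det _ (by simp only; omega)]
  have h1 := (TypeD.entryRecursion (n := n) c).det_skip l 0 (by omega)
  -- The minor lists its rows upwards with signs, `det_skip` downwards without.
  rw [← TypeD.det_signed_reverse] at h1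
  simp only [zero_add, TypeD.tailΘ_zero] at h1
  refine Eq.trans (congrArg Matrix.det ?_) (h1.trans ?_)
  · refine Matrix.ext fun (r s : Fin (l + 1)) => ?_
    have hr := r.2
    have hrev := Fin.val_rev r
    simp only [Matrix.of_apply]
    congr 1
    rcases Fin.eq_zero_or_eq_succ r.rev with h | ⟨q, h⟩
    · have h2 : r.rev.1 = 0 := congrArg Fin.val h
      rw [h, if_pos (by omega), Fin.cons_zero, add_comm 1 s.1]
      congr 2
      omega
    · have h2 : r.rev.1 = q.1 + 1 := congrArg Fin.val h
      rw [h, if_neg (by omega), Fin.cons_succ, add_comm 1 s.1]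
      congr 2
      omega
  -- Every index occurring here is at least `1`, so the convention `c_0 = 1` disappears from the
  -- result.
  · rw [add_comm, TypeD.param_of_pos _ le_rfl, Nat.add_sub_cancel]
    congr 1
    refine Finset.sum_bij (fun i _ => i + 1) ?_ ?_ ?_ ?_
    · intro i hi
      have := Finset.mem_range.mp hi
      exact Finset.mem_Icc.mpr ⟨by omega, by omega⟩
    · intro i _ j _ h
      omega
    · intro j hj
      have := Finset.mem_Icc.mp hj
      exact ⟨j - 1, Finset.mem_range.mpr (by omega), by omega⟩
    · intro i hi
      have := Finset.mem_range.mp hi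
      rw [TypeD.param_of_pos _ (by omega), TypeD.param_of_pos _ (by omega), Nat.add_sub_add_right]
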